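/- For a finite simple graph $G$, let $\lambda_1(G)\ge\lambda_2(G)\ge\cdots$ denote the eigenvalues of its adjacency matrix, counted with multiplicity; $\lambda_2(G)$ is its second eigenvalue. Say that a real number $\lambda$ has property $P_c$, where $c>0$, if there is an integer $\Delta$ (which may depend on $\lambda$) such that for infinitely many positive integers $n$ there is a connected $n$-vertex graph $G$ of maximum degree at most $\Delta$ with $\lambda_2(G)=\lambda$ and such that the multiplicity of $\lambda$ as an eigenvalue of $G$ is at least $c\log\log n$. There is an absolute constant $c>0$ such that infinitely many positive real numbers $\lambda$ have property $P_c$. In particular, $P_c$ holds for (a) every sufficiently large integer $\lambda$, and (b) $\lambda=2\sqrt{u^2+1}-1$ for every sufficiently large integer $u$. -/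

import Mathlib

theorem SimpleGraph.adjMatrix_real_isHermitian {V : Type*} (G : SimpleGraph V)
    [DecidableRel G.Adj] : (G.adjMatrix ℝ).IsHermitian := by
  rw [Matrix.IsHermitian, Matrix.conjTranspose_eq_transpose_of_trivial]
  exact G.isSymm_adjMatrix

/-- The graph has at least two vertices and the second largest eigenvalue of its adjacency matrix,
counted with multiplicity, is `lam`. (`eigenvalues₀` lists the eigenvalues with multiplicity in
nonincreasing order, starting at index `0`.) -/
def HasSecondEigenvalue {V : Type*} [Fintype V] [DecidableEq V] (G : SimpleGraph V)
    [DecidableRel G.Adj] (lam : ℝ) : Prop :=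
  ∃ h : 1 < Fintype.card V, G.adjMatrix_real_isHermitian.eigenvalues₀ ⟨1, h⟩ = lam

/-- The multiplicity of `lam` as an eigenvalue of the adjacency matrix: the dimension of its
eigenspace. -/
noncomputable def eigenvalueMultiplicity {V : Type*} [Fintype V] [DecidableEq V]
    (G : SimpleGraph V) [DecidableRel G.Adj] (lam : ℝ) : ℕ :=
  Module.finrank ℝ (Module.End.eigenspace (Matrix.toLin' (G.adjMatrix ℝ)) lam)

/-- For some degree bound `Δ`, there are infinitely many `n` for which some connected `n`-vertex
graph of maximum degree at most `Δ` has second eigenvalue exactly `lam`, of multiplicity at least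
`c * log (log n)`. -/
def HasLogLogMultiplicity (c lam : ℝ) : Prop :=
  ∃ Δ : ℕ, {n : ℕ | ∃ (G : SimpleGraph (Fin n)) (_ : DecidableRel G.Adj),
    G.Connected ∧ (∀ v, G.degree v ≤ Δ) ∧ HasSecondEigenvalue G lam ∧
      c * Real.log (Real.log n) ≤ (eigenvalueMultiplicity G lam : ℝ)}.Infinite

/-! A position is a pair (v, x): v a vertex of an expander on F_2^{4k}, x a label in F_2^k. Since
2^{4k} = 16^k, the vertices v can index all colourings of the k coordinates by 16 colours. A move
either follows the expander or adds to x the indicator of a colour class of v (a lamp). The Fourier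
transform in x splits this walk into sectors S ⊆ [k], in which the lamps become a potential on the
expander: the sum over classes of (-1)^|S ∩ class|. It is 16 for S = ∅, constantly 14 for a
singleton, at most 14 for |S| odd, and at most 12 for S ≠ ∅ even, except at the at most 1/16 of
colourings all of whose classes meet S evenly. The spectral gap (`expander_gap`, a ping-pong on
frequencies) prevents concentration there, so even sectors stay strictly below the value reached by
the k singleton characters (`sectorForm_le_of_even`, `block_sectorForm_le`). Hence that value is
second, with multiplicity at least k, while n = C * 32^k: the multiplicity is of order log n, more
than required.

To obtain a simple graph and to tune the eigenvalue, two copies of position × Y are joined, where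
the sum of the two coordinates in the abelian group Y selects the move (`switchGraph`). Most
selections are the identity; the functions of mean zero on the fibres Y are controlled independently
of their number (`sum_fibreDev_switchAt_le`). Adding p neighbours inside the first copy, and q
inside the second along x ↦ x + 1, which acts by -1 on odd sectors, makes the eigenvalue that of the
matrix with rows (p, R), (R, -q). Here p = q = 0 gives the integers, and p = 1, q = 3, R = 2u gives
2√(u²+1) - 1. -/

open Finset

/-- The nontrivial additive character of `ZMod 2`, with real values. -/
noncomputable def signChar (t : ZMod 2) : ℝ := if t = 0 then 1 else -1

theorem signChar_zero : signChar 0 = 1 := by simp [signChar]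

theorem signChar_one : signChar 1 = -1 := by simp [signChar]

theorem zmod_two_eq_zero_or_one (t : ZMod 2) : t = 0 ∨ t = 1 := by
  revert t; decide

theorem signChar_add (s t : ZMod 2) : signChar (s + t) = signChar s * signChar t := by
  have h : (1 : ZMod 2) + 1 = 0 := by decide
  rcases zmod_two_eq_zero_or_one s with rfl | rfl <;>
    rcases zmod_two_eq_zero_or_one t with rfl | rfl <;> simp [signChar, h]

theorem signChar_sum {ι : Type*} (s : Finset ι) (f : ι → ZMod 2) :
    signChar (∑ i ∈ s, f i) = ∏ i ∈ s, signChar (f i) := by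
  classical
  induction s using Finset.induction_on with
  | empty => simp [signChar_zero]
  | insert a s ha ih => rw [sum_insert ha, prod_insert ha, signChar_add, ih]

theorem zmod_two_add_self {ι : Type*} (x : ι → ZMod 2) : x + x = 0 := by
  funext i
  exact CharTwo.add_self_eq_zero (x i)

/-! ### Fourier analysis on F_2^ι -/

section Walsh

variable {ι : Type*} [Fintype ι]

/-- The Walsh character attached to `a`. -/
noncomputable def walshChar (a x : ι → ZMod 2) : ℝ := signChar (a ⬝ᵥ x)

theorem walshChar_add_right (a x y : ι → ZMod 2) :
    walshChar a (x + y) = walshChar a x * walshChar a y := by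
  rw [walshChar, dotProduct_add, signChar_add]; rfl

theorem walshChar_zero_left (x : ι → ZMod 2) : walshChar 0 x = 1 := by
  simp [walshChar, signChar_zero]

theorem walshChar_zero_right (x : ι → ZMod 2) : walshChar x 0 = 1 := by
  simp [walshChar, signChar_zero]

theorem walshChar_eq_one_or (a x : ι → ZMod 2) : walshChar a x = 1 ∨ walshChar a x = -1 := by
  unfold walshChar
  rcases zmod_two_eq_zero_or_one (a ⬝ᵥ x) with h | h <;> simp [h, signChar]

theorem sum_walshChar [DecidableEq ι] (x : ι → ZMod 2) :
    ∑ a : ι → ZMod 2, walshChar a x = if x = 0 then (2 : ℝ) ^ Fintype.card ι else 0 := by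
  have h1 : ∀ a : ι → ZMod 2, walshChar a x = ∏ i, signChar (a i * x i) := fun a => by
    rw [walshChar, dotProduct, signChar_sum]
  simp only [h1]
  have h2 := (Fintype.prod_sum (fun (i : ι) (t : ZMod 2) => signChar (t * x i)))
  rw [← h2]
  have h3 : ∀ i, ∑ t : ZMod 2, signChar (t * x i) = if x i = 0 then 2 else 0 := by
    intro i
    have h4 : ∀ f : ZMod 2 → ℝ, ∑ t : ZMod 2, f t = f 0 + f 1 := fun f => Fin.sum_univ_two f
    rw [h4]
    rcases zmod_two_eq_zero_or_one (x i) with h | h <;> simp [h, signChar]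
    norm_num
  simp only [h3]
  split_ifs with hx
  · simp [hx]
  · obtain ⟨i, hi⟩ := Function.ne_iff.mp hx
    exact prod_eq_zero (mem_univ i) (if_neg hi)

variable [DecidableEq ι]

/-- The Walsh transform. -/
noncomputable def walshTransform (f : (ι → ZMod 2) → ℝ) (a : ι → ZMod 2) : ℝ :=
  ∑ x, walshChar a x * f x

/-- Parseval's identity, with a translation. -/
theorem sum_walshTransform_mul (f g : (ι → ZMod 2) → ℝ) (s : ι → ZMod 2) :
    ∑ a, walshChar a s * walshTransform f a * walshTransform g a
      = 2 ^ Fintype.card ι * ∑ x, f x * g (x + s) := by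
  have h1 : ∀ a, walshChar a s * walshTransform f a * walshTransform g a
      = ∑ x, ∑ y, walshChar a (s + x + y) * (f x * g y) := by
    intro a
    rw [walshTransform, walshTransform, mul_assoc, sum_mul_sum, mul_sum]
    refine sum_congr rfl fun x _ => ?_
    rw [mul_sum]
    refine sum_congr rfl fun y _ => ?_
    rw [walshChar_add_right, walshChar_add_right]; ring
  simp only [h1]
  rw [sum_comm, mul_sum]
  refine sum_congr rfl fun x _ => ?_
  rw [sum_comm]
  simp only [← sum_mul, sum_walshChar]
  rw [sum_eq_single (x + s)]
  · rw [if_pos]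
    rw [add_comm s x]; exact zmod_two_add_self _
  · intro y _ hy
    rw [if_neg, zero_mul]
    intro h
    apply hy
    have : y = (s + x + y) + (s + x) := by
      have := zmod_two_add_self (s + x)
      calc y = y + 0 := by simp
        _ = _ := by rw [← this]; abel
    rw [this, h, zero_add, add_comm]
  · simp

theorem sum_walshTransform_sq (f : (ι → ZMod 2) → ℝ) :
    ∑ a, walshTransform f a ^ 2 = 2 ^ Fintype.card ι * ∑ x, f x ^ 2 := by
  have h := sum_walshTransform_mul f f 0
  simpa [walshChar_zero_right, ← pow_two] using h

theorem walshTransform_sub (f g : (ι → ZMod 2) → ℝ) (a : ι → ZMod 2) :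
    walshTransform (fun x => f x - g x) a = walshTransform f a - walshTransform g a := by
  simp [walshTransform, mul_sub, sum_sub_distrib]

theorem walshTransform_translate (f : (ι → ZMod 2) → ℝ) (s a : ι → ZMod 2) :
    walshTransform (fun x => f (x + s)) a = walshChar a s * walshTransform f a := by
  rw [walshTransform, walshTransform, mul_sum]
  rw [← Equiv.sum_comp (Equiv.addRight s)]
  refine sum_congr rfl fun x _ => ?_
  simp only [Equiv.coe_addRight]
  rw [add_assoc, zmod_two_add_self, add_zero, walshChar_add_right]; ring

end Walsh

/-! ### An explicit expander on F_2^{2r} and its spectral gap -/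

section Expander

/-- The matrix shifting the coordinates of the half `!c` down by `j + 1`, into the half `c`. -/
def shiftMatrix (r : ℕ) (c : Bool) (j : Fin 2) :
    Matrix (Bool × Fin r) (Bool × Fin r) (ZMod 2) :=
  fun p q => if p.1 = c ∧ q.1 = !c ∧ (q.2 : ℕ) = p.2 + j + 1 then 1 else 0

theorem shiftMatrix_mul_self (r : ℕ) (c : Bool) (j : Fin 2) :
    shiftMatrix r c j * shiftMatrix r c j = 0 := by
  ext p q
  rw [Matrix.mul_apply]
  refine sum_eq_zero fun t _ => ?_
  simp only [shiftMatrix]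
  split_ifs with h1 h2
  · have := h1.2.1.symm.trans h2.1
    simp at this
  all_goals simp

/-- The shear `1 + N` with `N` a shift matrix. -/
def shear (r : ℕ) (c : Bool) (j : Fin 2) (v : Bool × Fin r → ZMod 2) : Bool × Fin r → ZMod 2 :=
  v + (shiftMatrix r c j).mulVec v

/-- The transpose of `shear`. -/
def coshear (r : ℕ) (c : Bool) (j : Fin 2) (v : Bool × Fin r → ZMod 2) : Bool × Fin r → ZMod 2 :=
  v + (shiftMatrix r c j).transpose.mulVec v

theorem shear_involutive (r : ℕ) (c : Bool) (j : Fin 2) : Function.Involutive (shear r c j) := by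
  intro v
  simp only [shear, Matrix.mulVec_add, Matrix.mulVec_mulVec, shiftMatrix_mul_self,
    Matrix.zero_mulVec, add_zero]
  rw [add_assoc, zmod_two_add_self, add_zero]

theorem coshear_involutive (r : ℕ) (c : Bool) (j : Fin 2) :
    Function.Involutive (coshear r c j) := by
  intro v
  have h := congrArg Matrix.transpose (shiftMatrix_mul_self r c j)
  rw [Matrix.transpose_mul, Matrix.transpose_zero] at h
  simp only [coshear, Matrix.mulVec_add, Matrix.mulVec_mulVec, h, Matrix.zero_mulVec, add_zero]
  rw [add_assoc, zmod_two_add_self, add_zero]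

/-- Passing to the transpose moves the shears to the frequency side, where the ping-pong takes
place. -/
theorem walshChar_shear (r : ℕ) (c : Bool) (j : Fin 2) (a v : Bool × Fin r → ZMod 2) :
    walshChar a (shear r c j v) = walshChar (coshear r c j a) v := by
  rw [walshChar, walshChar, shear, coshear, dotProduct_add, add_dotProduct,
    Matrix.dotProduct_mulVec, Matrix.mulVec_transpose]

theorem walshTransform_shear (r : ℕ) (c : Bool) (j : Fin 2) (f : (Bool × Fin r → ZMod 2) → ℝ)
    (a : Bool × Fin r → ZMod 2) :
    walshTransform (fun v => f (shear r c j v)) a = walshTransform f (coshear r c j a) := by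
  rw [walshTransform, walshTransform, ← Equiv.sum_comp (shear_involutive r c j).toPerm]
  refine sum_congr rfl fun x _ => ?_
  simp only [Function.Involutive.coe_toPerm, walshChar_shear, shear_involutive r c j x]

/-- The degree (plus one) of the half `b` of `a`, read as a polynomial. -/
def halfDegree {r : ℕ} (b : Bool) (a : Bool × Fin r → ZMod 2) : ℕ :=
  univ.sup fun i : Fin r => if a (b, i) = 0 then 0 else (i : ℕ) + 1

theorem halfDegree_le_iff {r : ℕ} (b : Bool) (a : Bool × Fin r → ZMod 2) (n : ℕ) :
    halfDegree b a ≤ n ↔ ∀ i : Fin r, n < (i : ℕ) + 1 → a (b, i) = 0 := by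
  rw [halfDegree, Finset.sup_le_iff]
  refine ⟨fun h i hi => ?_, fun h i _ => ?_⟩
  · by_contra hne
    have := h i (mem_univ i)
    rw [if_neg hne] at this
    omega
  · split_ifs with h0
    · exact Nat.zero_le _
    · by_contra hlt
      exact h0 (h i (by omega))

theorem exists_of_halfDegree_pos {r : ℕ} (b : Bool) (a : Bool × Fin r → ZMod 2)
    (h : 0 < halfDegree b a) : ∃ i : Fin r, (i : ℕ) + 1 = halfDegree b a ∧ a (b, i) ≠ 0 := by
  by_contra hcon
  push Not at hcon
  have : halfDegree b a ≤ halfDegree b a - 1 := by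
    rw [halfDegree_le_iff]
    intro i hi
    rcases lt_or_ge (halfDegree b a) ((i : ℕ) + 1) with h1 | h1
    · exact (halfDegree_le_iff b a _).mp le_rfl i h1
    · exact hcon i (by omega)
  omega

theorem coshear_apply_same (r : ℕ) (c : Bool) (j : Fin 2) (a : Bool × Fin r → ZMod 2)
    (i : Fin r) : coshear r c j a (c, i) = a (c, i) := by
  simp only [coshear, Pi.add_apply, Matrix.mulVec, dotProduct, Matrix.transpose_apply]
  rw [sum_eq_zero, add_zero]
  intro q _
  simp [shiftMatrix]

/-- With the halves read as polynomials of degree less than r, this is multiplication of the half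
`c` by X^(j+1), truncated, and addition to the other half. -/
theorem coshear_apply_other (r : ℕ) (c : Bool) (j : Fin 2) (a : Bool × Fin r → ZMod 2)
    (i : Fin r) : coshear r c j a (!c, i)
      = a (!c, i) + ∑ q : Fin r, if (i : ℕ) = q + j + 1 then a (c, q) else 0 := by
  simp only [coshear, Pi.add_apply, Matrix.mulVec, dotProduct, Matrix.transpose_apply]
  congr 1
  rw [Fintype.sum_prod_type]
  rw [Fintype.sum_eq_single c]
  · refine sum_congr rfl fun q _ => ?_
    simp [shiftMatrix]
  · intro b hb
    refine sum_eq_zero fun q _ => ?_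
    simp [shiftMatrix, hb]

theorem halfDegree_coshear_same (r : ℕ) (c : Bool) (j : Fin 2) (a : Bool × Fin r → ZMod 2) :
    halfDegree c (coshear r c j a) = halfDegree c a := by
  simp only [halfDegree, coshear_apply_same]

/-- The top two coefficients of both halves vanish. -/
def IsLow {r : ℕ} (a : Bool × Fin r → ZMod 2) : Prop :=
  ∀ (b : Bool) (i : Fin r), r ≤ (i : ℕ) + 2 → a (b, i) = 0

/-- Lowness leaves room for a shift by at most 2, so nothing is truncated; the shifted leading term
lies above the whole of the other half and cannot cancel. -/
theorem halfDegree_coshear_other (r : ℕ) (c : Bool) (j : Fin 2) (a : Bool × Fin r → ZMod 2)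
    (hlow : IsLow a) (hle : halfDegree (!c) a ≤ halfDegree c a) (hpos : 0 < halfDegree c a) :
    halfDegree (!c) (coshear r c j a) = halfDegree c a + j + 1 := by
  obtain ⟨i₀, hi₀, hne⟩ := exists_of_halfDegree_pos c a hpos
  have hi₀r : (i₀ : ℕ) + 2 < r := by
    by_contra hcon
    exact hne (hlow c i₀ (by omega))
  have hj := j.isLt
  apply le_antisymm
  · rw [halfDegree_le_iff]
    intro i hi
    rw [coshear_apply_other, (halfDegree_le_iff _ _ _).mp hle i (by omega), zero_add]
    refine sum_eq_zero fun q _ => ?_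
    split_ifs with hq
    · exact (halfDegree_le_iff _ _ _).mp le_rfl q (by omega)
    · rfl
  · by_contra hcon
    have h1 : halfDegree (!c) (coshear r c j a) ≤ halfDegree c a + j := by omega
    have h2 := (halfDegree_le_iff _ _ _).mp h1 ⟨i₀ + j + 1, by omega⟩ (by simp only; omega)
    rw [coshear_apply_other, (halfDegree_le_iff _ _ _).mp hle _ (by simp only; omega), zero_add,
      sum_eq_single i₀] at h2
    · simp at h2; exact hne h2
    · intro q _ hq
      rw [if_neg]
      intro h
      apply hq
      ext
      simp only at h
      omega
    · simp

theorem eq_zero_of_halfDegree {r : ℕ} (a : Bool × Fin r → ZMod 2)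
    (h : ∀ b, halfDegree b a = 0) : a = 0 := by
  funext ⟨b, i⟩
  exact (halfDegree_le_iff b a 0).mp (h b).le i (Nat.succ_pos _)

open Classical in
/-- Ping-pong on the frequency side. -/
theorem sum_coshear_sq_le (r : ℕ) (F : (Bool × Fin r → ZMod 2) → ℝ) :
    ∑ t : Bool × Fin 2, ∑ a ∈ univ.filter (fun a : Bool × Fin r → ZMod 2 =>
      IsLow a ∧ halfDegree (!t.1) a ≤ halfDegree t.1 a ∧ 0 < halfDegree t.1 a),
        F (coshear r t.1 t.2 a) ^ 2 ≤ ∑ a, F a ^ 2 := by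
  rw [sum_sigma']
  have hinj : Set.InjOn (fun q : (_ : Bool × Fin 2) × (Bool × Fin r → ZMod 2) =>
      coshear r q.1.1 q.1.2 q.2) ((univ : Finset (Bool × Fin 2)).sigma fun t =>
        univ.filter (fun a : Bool × Fin r → ZMod 2 =>
      IsLow a ∧ halfDegree (!t.1) a ≤ halfDegree t.1 a ∧ 0 < halfDegree t.1 a) : Finset _) := by
    rintro ⟨⟨c, j⟩, a⟩ h ⟨⟨c', j'⟩, a'⟩ h' heq
    simp only [coe_sigma, Set.mem_sigma_iff, coe_univ, Set.mem_univ, true_and, coe_filter,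
      mem_univ, Set.mem_ofPred_eq] at h h' heq
    have e1 := halfDegree_coshear_other r c j a h.1 h.2.1 h.2.2
    have e2 := halfDegree_coshear_same r c j a
    have e1' := halfDegree_coshear_other r c' j' a' h'.1 h'.2.1 h'.2.2
    have e2' := halfDegree_coshear_same r c' j' a'
    rw [← heq] at e1' e2'
    -- In the image the strictly larger half is `!c`, and it exceeds the half `c` by j + 1. So the
    -- image determines both `c` and `j`: the four image sets are disjoint.
    have hc : c = c' := by
      by_contra hne
      have : c' = !c := by cases c <;> cases c' <;> simp_all
      subst this
      rw [Bool.not_not] at e1'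
      omega
    subst hc
    have hj : j = j' := by ext; omega
    subst hj
    have := (coshear_involutive r c j).injective heq
    subst this
    rfl
  have h2 := Finset.sum_image (f := fun a => F a ^ 2) hinj
  rw [← h2]
  exact sum_le_sum_of_subset_of_nonneg (subset_univ _) fun _ _ _ => sq_nonneg _

/-- The vector detecting the coefficient of index `r - 1 - j` of the half `c`. -/
def topVector (r : ℕ) (c : Bool) (j : Fin 2) : Bool × Fin r → ZMod 2 :=
  fun p => if p.1 = c ∧ (p.2 : ℕ) + j + 1 = r then 1 else 0

/-- The eight involutions generating the expander: translations and shears. -/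
def expanderMap (r : ℕ) : Bool × Bool × Fin 2 → (Bool × Fin r → ZMod 2) → Bool × Fin r → ZMod 2
  | (false, c, j), v => v + topVector r c j
  | (true, c, j), v => shear r c j v

theorem expanderMap_involutive (r : ℕ) (g : Bool × Bool × Fin 2) :
    Function.Involutive (expanderMap r g) := by
  obtain ⟨b, c, j⟩ := g
  cases b
  · intro v
    simp only [expanderMap]
    rw [add_assoc, zmod_two_add_self, add_zero]
  · exact shear_involutive r c j

/-- The translations are there for the frequencies that a shear could truncate: each of them is
negated by some translation. -/
theorem exists_walshChar_topVector {r : ℕ} (a : Bool × Fin r → ZMod 2) (h : ¬ IsLow a) :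
    ∃ t : Bool × Fin 2, walshChar a (topVector r t.1 t.2) = -1 := by
  unfold IsLow at h
  push Not at h
  obtain ⟨b, i, hi, hne⟩ := h
  have hir := i.isLt
  refine ⟨(b, ⟨r - 1 - i, by omega⟩), ?_⟩
  have h1 : a ⬝ᵥ topVector r b ⟨r - 1 - i, by omega⟩ = a (b, i) := by
    rw [dotProduct, sum_eq_single (b, i)]
    · simp only [topVector]
      rw [if_pos ⟨trivial, by omega⟩, mul_one]
    · rintro ⟨b', i'⟩ _ hne'
      simp only [topVector]
      rw [if_neg, mul_zero]
      rintro ⟨rfl, h2⟩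
      apply hne'
      have : i' = i := by ext; omega
      rw [this]
    · simp
  rw [walshChar, h1]
  simp [signChar, hne]

/-- This is (5b - 4a)² ≥ 0. The factor 4/5 exceeds 1/2, so it survives the doubling in the
ping-pong. -/
theorem sq_sub_le (a b : ℝ) : 4 / 5 * a ^ 2 - 4 * (b - a) ^ 2 ≤ b ^ 2 := by
  nlinarith [sq_nonneg (5 * b - 4 * a)]

/-- The spectral gap of the expander. -/
theorem expander_gap (r : ℕ) (f : (Bool × Fin r → ZMod 2) → ℝ) (hf : ∑ v, f v = 0) :
    3 / 20 * ∑ v, f v ^ 2 ≤ ∑ g, ∑ v, (f (expanderMap r g v) - f v) ^ 2 := by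
  classical
  set F := walshTransform f with hF
  have hF0 : F 0 = 0 := by simp [hF, walshTransform, walshChar_zero_left, hf]
  set K : ℝ := 2 ^ Fintype.card (Bool × Fin r) with hK
  have hKpos : 0 < K := by positivity
  have hshear : ∀ t : Bool × Fin 2, K * ∑ v, (f (expanderMap r (true, t) v) - f v) ^ 2
      = ∑ a, (F (coshear r t.1 t.2 a) - F a) ^ 2 := by
    intro t
    rw [hK, ← sum_walshTransform_sq]
    refine sum_congr rfl fun a _ => ?_
    rw [walshTransform_sub]
    simp only [expanderMap]
    rw [walshTransform_shear]
  have htrans : ∀ t : Bool × Fin 2, K * ∑ v, (f (expanderMap r (false, t) v) - f v) ^ 2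
      = ∑ a, (walshChar a (topVector r t.1 t.2) * F a - F a) ^ 2 := by
    intro t
    rw [hK, ← sum_walshTransform_sq]
    refine sum_congr rfl fun a _ => ?_
    rw [walshTransform_sub]
    simp only [expanderMap]
    rw [walshTransform_translate]
  have hpars : K * ∑ v, f v ^ 2 = ∑ a, F a ^ 2 := (sum_walshTransform_sq f).symm
  -- A negated frequency contributes (-2F)² = 4F² to the energy, whence the factor 1/4.
  have hhigh : ∑ a ∈ univ.filter (fun a : Bool × Fin r → ZMod 2 => ¬ IsLow a), F a ^ 2
      ≤ 1 / 4 * ∑ t : Bool × Fin 2,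
        ∑ a, (walshChar a (topVector r t.1 t.2) * F a - F a) ^ 2 := by
    rw [sum_comm, mul_sum]
    refine (sum_le_sum fun a ha => ?_).trans
      (sum_le_sum_of_subset_of_nonneg (subset_univ _) fun _ _ _ => ?_)
    · obtain ⟨t, ht⟩ := exists_walshChar_topVector a (mem_filter.mp ha).2
      have h1 := single_le_sum (f := fun t : Bool × Fin 2 =>
        (walshChar a (topVector r t.1 t.2) * F a - F a) ^ 2)
        (fun _ _ => sq_nonneg _) (mem_univ t)
      simp only [ht] at h1
      nlinarith
    · exact mul_nonneg (by norm_num) (sum_nonneg fun _ _ => sq_nonneg _)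
  -- A nonzero low frequency has a nonzero half at least as large as the other; the zero frequency
  -- drops out because `f` has sum zero.
  have hlow : ∑ a ∈ univ.filter (fun a : Bool × Fin r → ZMod 2 => IsLow a), F a ^ 2
      ≤ ∑ c : Bool, ∑ a ∈ univ.filter (fun a : Bool × Fin r → ZMod 2 =>
      IsLow a ∧ halfDegree (!c) a ≤ halfDegree c a ∧ 0 < halfDegree c a), F a ^ 2 := by
    simp only [sum_filter]
    rw [sum_comm]
    refine sum_le_sum fun a _ => ?_
    split_ifs with h1
    · by_cases h0 : a = 0
      · rw [h0, hF0]
        simp only [ne_eq, OfNat.ofNat_ne_zero, not_false_eq_true, zero_pow]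
        exact sum_nonneg fun _ _ => by split_ifs <;> simp
      · have h2 : ∃ c, halfDegree (!c) a ≤ halfDegree c a ∧ 0 < halfDegree c a := by
          by_contra hcon
          push Not at hcon
          apply h0
          apply eq_zero_of_halfDegree
          have ht := hcon true
          have hf := hcon false
          simp only [Bool.not_true, Bool.not_false] at ht hf
          intro b
          cases b <;> omega
        obtain ⟨c, hc⟩ := h2
        refine le_trans ?_ (single_le_sum (f := fun c : Bool => if IsLow a ∧
          halfDegree (!c) a ≤ halfDegree c a ∧ 0 < halfDegree c a then F a ^ 2 else 0)
          (fun _ _ => by split_ifs <;> positivity) (mem_univ c))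
        rw [if_pos ⟨h1, hc⟩]
    · exact sum_nonneg fun _ _ => by split_ifs <;> positivity
  have hping := sum_coshear_sq_le r F
  have hping' : ∑ t : Bool × Fin 2, (4 / 5 * (∑ a ∈ univ.filter
      (fun a : Bool × Fin r → ZMod 2 =>
      IsLow a ∧ halfDegree (!t.1) a ≤ halfDegree t.1 a ∧ 0 < halfDegree t.1 a), F a ^ 2)
        - 4 * ∑ a, (F (coshear r t.1 t.2 a) - F a) ^ 2) ≤ ∑ a, F a ^ 2 := by
    refine le_trans (sum_le_sum fun t _ => ?_) hping
    have h1 : ∑ a ∈ univ.filter (fun a : Bool × Fin r → ZMod 2 =>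
      IsLow a ∧ halfDegree (!t.1) a ≤ halfDegree t.1 a ∧ 0 < halfDegree t.1 a),
        (F (coshear r t.1 t.2 a) - F a) ^ 2 ≤ ∑ a, (F (coshear r t.1 t.2 a) - F a) ^ 2 :=
      sum_le_sum_of_subset_of_nonneg (subset_univ _) fun _ _ _ => sq_nonneg _
    have h2 := sum_le_sum (s := univ.filter (fun a : Bool × Fin r → ZMod 2 =>
      IsLow a ∧ halfDegree (!t.1) a ≤ halfDegree t.1 a ∧ 0 < halfDegree t.1 a))
      fun a _ => sq_sub_le (F a) (F (coshear r t.1 t.2 a))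
    rw [sum_sub_distrib, ← mul_sum, ← mul_sum] at h2
    linarith
  -- Each half `c` is used by two shears, so 4/5 becomes 8/5 > 1: the low mass satisfies (8/5) low ≤
  -- total + 4 (shear energy).
  rw [sum_sub_distrib, ← mul_sum, ← mul_sum, Fintype.sum_prod_type] at hping'
  simp only [sum_const, card_univ, Fintype.card_fin, nsmul_eq_mul, Nat.cast_ofNat,
    ← mul_sum] at hping'
  have hsplit := sum_filter_add_sum_filter_not univ
    (fun a : Bool × Fin r → ZMod 2 => IsLow a) (fun a => F a ^ 2)
  have hgens : K * ∑ g, ∑ v, (f (expanderMap r g v) - f v) ^ 2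
      = (∑ t : Bool × Fin 2, ∑ a, (F (coshear r t.1 t.2 a) - F a) ^ 2)
        + ∑ t : Bool × Fin 2, ∑ a, (walshChar a (topVector r t.1 t.2) * F a - F a) ^ 2 := by
    rw [mul_sum, Fintype.sum_prod_type, Fintype.sum_bool]
    simp only [hshear, htrans]
  have hT : 0 ≤ ∑ t : Bool × Fin 2, ∑ a,
      (walshChar a (topVector r t.1 t.2) * F a - F a) ^ 2 :=
    sum_nonneg fun _ _ => sum_nonneg fun _ _ => sq_nonneg _
  refine le_of_mul_le_mul_left ?_ hKpos
  -- With total = low + high this gives (3/5) total ≤ (8/5) high + 4 (shear energy) ≤ 4 (energy),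
  -- which is the constant 3/20.
  rw [hgens]
  linarith

end Expander

/-! ### The lamp potential of a colouring -/

section Lamps

/-- The indicator of the colour class `l`. -/
def lampVector {k : ℕ} (c : Fin k → Fin 16) (l : Fin 16) : Fin k → ZMod 2 :=
  fun i => if c i = l then 1 else 0

/-- The sum over the colour classes of the values of a Walsh character. -/
noncomputable def lampPotential {k : ℕ} (c : Fin k → Fin 16) (S : Fin k → ZMod 2) : ℝ :=
  ∑ l, walshChar S (lampVector c l)

theorem dotProduct_lampVector {k : ℕ} (c : Fin k → Fin 16) (S : Fin k → ZMod 2) (l : Fin 16) :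
    S ⬝ᵥ lampVector c l = ∑ i, if c i = l then S i else 0 := by
  simp [dotProduct, lampVector]

theorem sum_dotProduct_lampVector {k : ℕ} (c : Fin k → Fin 16) (S : Fin k → ZMod 2) :
    ∑ l, S ⬝ᵥ lampVector c l = ∑ i, S i := by
  simp only [dotProduct_lampVector]
  rw [sum_comm]
  simp

/-- Exactly one class contains `i`, whatever the colouring. The independence from `c` is what makes
the singleton characters exact eigenvectors. -/
theorem lampPotential_single {k : ℕ} (c : Fin k → Fin 16) (i : Fin k) :
    lampPotential c (Pi.single i 1) = 14 := by
  have h : ∀ l, walshChar (Pi.single i 1) (lampVector c l)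
      = 1 - if c i = l then (2 : ℝ) else 0 := by
    intro l
    rw [walshChar, single_dotProduct, one_mul, lampVector]
    split_ifs
    · rw [signChar_one]; norm_num
    · rw [signChar_zero]; norm_num
  simp only [lampPotential, h, sum_sub_distrib, sum_ite_eq, mem_univ, if_true]
  norm_num

theorem lampPotential_le_of_subset {k : ℕ} (c : Fin k → Fin 16) (S : Fin k → ZMod 2)
    (s : Finset (Fin 16)) (hs : ∀ l ∈ s, S ⬝ᵥ lampVector c l ≠ 0) :
    lampPotential c S ≤ 16 - 2 * s.card := by
  have h : ∀ l, walshChar S (lampVector c l) ≤ 1 - if l ∈ s then (2 : ℝ) else 0 := by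
    intro l
    split_ifs with hl
    · rw [walshChar, signChar, if_neg (hs l hl)]; norm_num
    · rcases walshChar_eq_one_or S (lampVector c l) with h | h <;> rw [h] <;> norm_num
  refine (sum_le_sum fun l _ => h l).trans ?_
  rw [sum_sub_distrib, ← sum_filter]
  simp
  linarith

theorem lampPotential_le {k : ℕ} (c : Fin k → Fin 16) (S : Fin k → ZMod 2) :
    lampPotential c S ≤ 16 := by
  simpa using lampPotential_le_of_subset c S ∅ (by simp)

theorem neg_le_lampPotential {k : ℕ} (c : Fin k → Fin 16) (S : Fin k → ZMod 2) :
    -16 ≤ lampPotential c S := by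
  have h : ∀ l, -1 ≤ walshChar S (lampVector c l) := fun l => by
    rcases walshChar_eq_one_or S (lampVector c l) with h | h <;> rw [h]; norm_num
  have := sum_le_sum (s := univ) fun l _ => h l
  simpa [lampPotential] using this

/-- The parities of the classes add up to that of `S`, so some class meets `S` oddly. -/
theorem lampPotential_le_of_odd {k : ℕ} (c : Fin k → Fin 16) (S : Fin k → ZMod 2)
    (hS : ∑ i, S i ≠ 0) : lampPotential c S ≤ 14 := by
  rw [← sum_dotProduct_lampVector c] at hS
  obtain ⟨l, -, hl⟩ := exists_ne_zero_of_sum_ne_zero hS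
  have := lampPotential_le_of_subset c S {l} (by simpa using hl)
  simp at this
  linarith

/-- The number of classes meeting `S` oddly is even, so it is at least two once it is nonzero. -/
theorem lampPotential_le_of_even {k : ℕ} (c : Fin k → Fin 16) (S : Fin k → ZMod 2)
    (hS : ∑ i, S i = 0) (h : ¬ ∀ l, S ⬝ᵥ lampVector c l = 0) : lampPotential c S ≤ 12 := by
  push Not at h
  obtain ⟨l, hl⟩ := h
  rw [← sum_dotProduct_lampVector c, ← add_sum_erase univ _ (mem_univ l)] at hS
  have h2 : ∑ l' ∈ univ.erase l, S ⬝ᵥ lampVector c l' ≠ 0 := by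
    intro h0
    rw [h0, add_zero] at hS
    exact hl hS
  obtain ⟨l', hl', hne⟩ := exists_ne_zero_of_sum_ne_zero h2
  have h3 := lampPotential_le_of_subset c S {l, l'} (by
    intro x hx
    rw [mem_insert, mem_singleton] at hx
    rcases hx with rfl | rfl <;> assumption)
  rw [card_pair (ne_of_mem_erase hl').symm] at h3
  norm_num at h3
  linarith

/-- A nonzero `S` meets every colour class evenly for at most one colouring in `16`. -/
theorem card_even_colourings_le {k : ℕ} (S : Fin k → ZMod 2) (hS : S ≠ 0) :
    16 * (univ.filter fun c : Fin k → Fin 16 => ∀ l, S ⬝ᵥ lampVector c l = 0).card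
      ≤ Fintype.card (Fin k → Fin 16) := by
  obtain ⟨i₀, hi₀⟩ := Function.ne_iff.mp hS
  have hS1 : S i₀ = 1 := (zmod_two_eq_zero_or_one _).resolve_left hi₀
  set B := univ.filter fun c : Fin k → Fin 16 => ∀ l, S ⬝ᵥ lampVector c l = 0 with hB
  have hcard : (B ×ˢ (univ : Finset (Fin 16))).card = 16 * B.card := by
    rw [card_product, card_univ, Fintype.card_fin, mul_comm]
  rw [← hcard, ← card_univ]
  -- Recolouring a point `i₀` of `S` in all 16 ways is injective on even colourings: they are
  -- determined by their values off `i₀`.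
  refine card_le_card_of_injOn (fun q => Function.update q.1 i₀ q.2) (fun _ _ => by simp) ?_
  rintro ⟨c, t⟩ h ⟨c', t'⟩ h' heq
  simp only [coe_product, coe_univ, Set.mem_prod, mem_coe, Set.mem_univ, and_true, hB,
    mem_filter, mem_univ, true_and] at h h' heq
  have ht : t = t' := by
    have := congrFun heq i₀
    simpa using this
  have hoff : ∀ i, i ≠ i₀ → c i = c' i := by
    intro i hi
    have := congrFun heq i
    simpa [hi] using this
  -- The colour of `i₀` must be the one class that the rest of `S` meets oddly.
  have key : c i₀ = c' i₀ := by
    have h1 := h (c i₀)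
    have h2 := h' (c i₀)
    rw [dotProduct_lampVector, ← add_sum_erase univ _ (mem_univ i₀)] at h1 h2
    rw [if_pos rfl, hS1] at h1
    have h3 : ∑ i ∈ univ.erase i₀, (if c' i = c i₀ then S i else 0)
        = ∑ i ∈ univ.erase i₀, (if c i = c i₀ then S i else 0) :=
      sum_congr rfl fun i hi => by rw [hoff i (ne_of_mem_erase hi)]
    rw [h3] at h2
    by_contra hne
    rw [if_neg (Ne.symm hne), zero_add] at h2
    rw [h2] at h1
    exact absurd h1 (by decide)
  have hc : c = c' := by
    funext i
    by_cases hi : i = i₀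
    · rw [hi, key]
    · exact hoff i hi
  rw [hc, ht]

end Lamps

/-! ### Quadratic forms in one Fourier sector -/

section Sector

variable {k : ℕ}

/-- Colourings are indexed by the vertices of the expander. -/
noncomputable def colouring (k : ℕ) : (Bool × Fin (2 * k) → ZMod 2) ≃ (Fin k → Fin 16) :=
  Fintype.equivOfCardEq (by
    simp only [Fintype.card_fun, ZMod.card, Fintype.card_prod, Fintype.card_bool,
      Fintype.card_fin]
    rw [show 2 * (2 * k) = 4 * k by ring, pow_mul]
    norm_num)

/-- The bilinear form of the operator in the sector of the Walsh character `S`: `ρ` times the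
identity, `540` copies of each expander map, and `6` copies of each lamp. -/
noncomputable def sectorForm (ρ : ℝ) (S : Fin k → ZMod 2)
    (A B : (Bool × Fin (2 * k) → ZMod 2) → ℝ) : ℝ :=
  ρ * ∑ v, A v * B v + 540 * ∑ g, ∑ v, A v * B (expanderMap (2 * k) g v)
    + 6 * ∑ v, lampPotential (colouring k v) S * (A v * B v)

theorem sum_expanderMap (g : Bool × Bool × Fin 2)
    (f : (Bool × Fin (2 * k) → ZMod 2) → ℝ) :
    ∑ v, f (expanderMap (2 * k) g v) = ∑ v, f v :=
  Equiv.sum_comp (expanderMap_involutive (2 * k) g).toPerm f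

theorem sum_mul_expanderMap (g : Bool × Bool × Fin 2)
    (A B : (Bool × Fin (2 * k) → ZMod 2) → ℝ) :
    ∑ v, A (expanderMap (2 * k) g v) * B v = ∑ v, A v * B (expanderMap (2 * k) g v) := by
  rw [← sum_expanderMap g]
  simp only [expanderMap_involutive (2 * k) g _]

/-- The Dirichlet form of the expander. -/
noncomputable def expanderEnergy (f : (Bool × Fin (2 * k) → ZMod 2) → ℝ) : ℝ :=
  ∑ g, ∑ v, (f (expanderMap (2 * k) g v) - f v) ^ 2

theorem expanderEnergy_nonneg (f : (Bool × Fin (2 * k) → ZMod 2) → ℝ) :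
    0 ≤ expanderEnergy f :=
  sum_nonneg fun _ _ => sum_nonneg fun _ _ => sq_nonneg _

theorem sectorForm_self (ρ : ℝ) (S : Fin k → ZMod 2)
    (f : (Bool × Fin (2 * k) → ZMod 2) → ℝ) :
    sectorForm ρ S f f = (ρ + 4320) * ∑ v, f v ^ 2 - 270 * expanderEnergy f
      + 6 * ∑ v, lampPotential (colouring k v) S * f v ^ 2 := by
  have h : expanderEnergy f = 16 * ∑ v, f v ^ 2
      - 2 * ∑ g, ∑ v, f v * f (expanderMap (2 * k) g v) := by
    have h1 : ∀ g, ∑ v, (f (expanderMap (2 * k) g v) - f v) ^ 2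
        = 2 * ∑ v, f v ^ 2 - 2 * ∑ v, f v * f (expanderMap (2 * k) g v) := by
      intro g
      have h2 := sum_expanderMap g fun v => f v ^ 2
      have h3 : ∀ v, (f (expanderMap (2 * k) g v) - f v) ^ 2
          = f (expanderMap (2 * k) g v) ^ 2 + f v ^ 2
            - 2 * (f v * f (expanderMap (2 * k) g v)) := fun v => by ring
      simp only [h3, sum_sub_distrib, sum_add_distrib, h2, ← mul_sum]
      ring
    simp only [expanderEnergy, h1, sum_sub_distrib, ← mul_sum]
    simp
    ring
  rw [h, sectorForm]
  simp only [← pow_two]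
  ring

/-- There are 540 * 8 + 6 * 16 = 4416 moves, each of norm at most one, so this much identity
outweighs them. -/
theorem sectorForm_self_nonneg (ρ : ℝ) (hρ : 4416 ≤ ρ) (S : Fin k → ZMod 2)
    (f : (Bool × Fin (2 * k) → ZMod 2) → ℝ) : 0 ≤ sectorForm ρ S f f := by
  have h1 : ∀ g, -∑ v, f v ^ 2 ≤ ∑ v, f v * f (expanderMap (2 * k) g v) := by
    intro g
    have h2 := sum_expanderMap g fun v => f v ^ 2
    have h3 : 0 ≤ ∑ v, (f (expanderMap (2 * k) g v) + f v) ^ 2 :=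
      sum_nonneg fun _ _ => sq_nonneg _
    have h4 : ∀ v, (f (expanderMap (2 * k) g v) + f v) ^ 2
        = f (expanderMap (2 * k) g v) ^ 2 + f v ^ 2
          + 2 * (f v * f (expanderMap (2 * k) g v)) := fun v => by ring
    simp only [h4, sum_add_distrib, h2, ← mul_sum] at h3
    linarith
  have h5 := sum_le_sum (s := univ) fun g _ => h1 g
  have h6 : -16 * ∑ v, f v ^ 2 ≤ ∑ v, lampPotential (colouring k v) S * f v ^ 2 := by
    rw [mul_sum]
    exact sum_le_sum fun v _ =>
      mul_le_mul_of_nonneg_right (neg_le_lampPotential _ _) (sq_nonneg _)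
  simp at h5
  have h7 : 0 ≤ ∑ v, f v ^ 2 := sum_nonneg fun _ _ => sq_nonneg _
  rw [sectorForm]
  simp only [← pow_two]
  nlinarith

theorem sectorForm_comm (ρ : ℝ) (S : Fin k → ZMod 2)
    (A B : (Bool × Fin (2 * k) → ZMod 2) → ℝ) : sectorForm ρ S A B = sectorForm ρ S B A := by
  have h : ∀ g, ∑ v, A v * B (expanderMap (2 * k) g v)
      = ∑ v, B v * A (expanderMap (2 * k) g v) := fun g => by
    rw [← sum_mul_expanderMap]
    exact sum_congr rfl fun v _ => mul_comm _ _
  simp only [sectorForm, h, mul_comm (B _) (A _)]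

theorem sectorForm_sub_self (ρ : ℝ) (S : Fin k → ZMod 2) (t : ℝ)
    (A B : (Bool × Fin (2 * k) → ZMod 2) → ℝ) :
    sectorForm ρ S (fun v => t * A v - B v) (fun v => t * A v - B v)
      = t ^ 2 * sectorForm ρ S A A - 2 * t * sectorForm ρ S A B + sectorForm ρ S B B := by
  have h1 : sectorForm ρ S (fun v => t * A v - B v) (fun v => t * A v - B v)
      = t ^ 2 * sectorForm ρ S A A - t * sectorForm ρ S A B - t * sectorForm ρ S B A
        + sectorForm ρ S B B := by
    simp only [sectorForm, mul_add, mul_sum]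
    have h2 : ∀ a b c d : ℝ, (t * a - b) * (t * c - d)
      = t ^ 2 * (a * c) - t * (a * d) - t * (b * c) + b * d := fun a b c d => by ring
    simp only [h2, mul_add, mul_sub, sum_add_distrib, sum_sub_distrib]
    simp only [mul_left_comm _ t, mul_left_comm _ (t ^ 2)]
    ring
  rw [h1, sectorForm_comm ρ S B A]; ring

/-- Weighted arithmetic-geometric bound for the (positive semidefinite) sector forms. -/
theorem two_mul_sectorForm_le (ρ : ℝ) (hρ : 4416 ≤ ρ) (S : Fin k → ZMod 2) (t : ℝ) (ht : 0 < t)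
    (A B : (Bool × Fin (2 * k) → ZMod 2) → ℝ) :
    2 * sectorForm ρ S A B ≤ t * sectorForm ρ S A A + t⁻¹ * sectorForm ρ S B B := by
  have h := sectorForm_self_nonneg ρ hρ S (fun v => t * A v - B v)
  rw [sectorForm_sub_self] at h
  have h2 := mul_nonneg (inv_nonneg.mpr ht.le) h
  have h3 : t⁻¹ * (t ^ 2 * sectorForm ρ S A A - 2 * t * sectorForm ρ S A B + sectorForm ρ S B B)
      = t * sectorForm ρ S A A - 2 * sectorForm ρ S A B + t⁻¹ * sectorForm ρ S B B := by
    field_simp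
  linarith

/-- 4404 = 540 * 8 + 6 * 14; a singleton `S` attains this value at constant functions. -/
theorem sectorForm_le_of_odd (ρ : ℝ) (S : Fin k → ZMod 2) (hS : ∑ i, S i ≠ 0)
    (f : (Bool × Fin (2 * k) → ZMod 2) → ℝ) :
    sectorForm ρ S f f ≤ (ρ + 4404) * ∑ v, f v ^ 2 := by
  have h6 : ∑ v, lampPotential (colouring k v) S * f v ^ 2 ≤ 14 * ∑ v, f v ^ 2 := by
    rw [mul_sum]
    exact sum_le_sum fun v _ =>
      mul_le_mul_of_nonneg_right (lampPotential_le_of_odd _ _ hS) (sq_nonneg _)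
  rw [sectorForm_self]
  linarith [expanderEnergy_nonneg f]

/-- The gap subtracts 270 * 3/20 = 40.5 from 4320 + 6 * 16 = 4416. -/
theorem sectorForm_le_of_sum_eq_zero (ρ : ℝ) (S : Fin k → ZMod 2)
    (f : (Bool × Fin (2 * k) → ZMod 2) → ℝ) (hf : ∑ v, f v = 0) :
    sectorForm ρ S f f ≤ (ρ + 4400) * ∑ v, f v ^ 2 := by
  have h6 : ∑ v, lampPotential (colouring k v) S * f v ^ 2 ≤ 16 * ∑ v, f v ^ 2 := by
    rw [mul_sum]
    exact sum_le_sum fun v _ =>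
      mul_le_mul_of_nonneg_right (lampPotential_le _ _) (sq_nonneg _)
  have h7 := expander_gap (2 * k) f hf
  have h8 : 0 ≤ ∑ v, f v ^ 2 := sum_nonneg fun _ _ => sq_nonneg _
  rw [sectorForm_self, expanderEnergy]
  linarith

/-- The potential exceeds 12 only on the sparse set `B`. The constant part of `f` has at most 1/16
of its mass there, and the rest pays for itself through the gap. -/
theorem sectorForm_le_of_even (ρ : ℝ) (S : Fin k → ZMod 2) (hS : ∑ i, S i = 0) (hS0 : S ≠ 0)
    (f : (Bool × Fin (2 * k) → ZMod 2) → ℝ) :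
    sectorForm ρ S f f ≤ (ρ + 4400) * ∑ v, f v ^ 2 := by
  classical
  set B : Finset (Bool × Fin (2 * k) → ZMod 2) :=
    univ.filter fun v => ∀ l, S ⬝ᵥ lampVector (colouring k v) l = 0 with hB
  set N : ℝ := ((Fintype.card (Bool × Fin (2 * k) → ZMod 2) : ℕ) : ℝ) with hN
  have hNpos : 0 < N := by
    rw [hN]; exact_mod_cast Fintype.card_pos
  have hBcard : 16 * (B.card : ℝ) ≤ N := by
    have h1 : B.card = (univ.filter fun c : Fin k → Fin 16 =>
        ∀ l, S ⬝ᵥ lampVector c l = 0).card := by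
      rw [hB, ← card_map (colouring k).toEmbedding]
      congr 1
      ext c
      simp only [mem_map_equiv, mem_filter, mem_univ, true_and, Equiv.apply_symm_apply]
    have h2 := card_even_colourings_le S hS0
    rw [← h1, ← Fintype.card_congr (colouring k)] at h2
    rw [hN]; exact_mod_cast h2
  set m : ℝ := (∑ v, f v) / N with hm
  set h : (Bool × Fin (2 * k) → ZMod 2) → ℝ := fun v => f v - m with hh
  have hsum : ∑ v, h v = 0 := by
    simp only [hh, sum_sub_distrib, sum_const, card_univ, nsmul_eq_mul, ← hN, hm]
    field_simp
    ring
  have hsq : ∑ v, f v ^ 2 = N * m ^ 2 + ∑ v, h v ^ 2 := by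
    have h1 : ∀ v, f v ^ 2 = m ^ 2 + 2 * m * h v + h v ^ 2 := fun v => by
      simp only [hh]; ring
    simp only [h1, sum_add_distrib, ← mul_sum, hsum, sum_const, card_univ, nsmul_eq_mul, ← hN]
    ring
  have hen : expanderEnergy f = expanderEnergy h := by
    simp only [expanderEnergy, hh, sub_sub_sub_cancel_right]
  have hgap := expander_gap (2 * k) h hsum
  have hpot : ∑ v, lampPotential (colouring k v) S * f v ^ 2
      ≤ 12 * ∑ v, f v ^ 2 + 4 * ∑ v ∈ B, f v ^ 2 := by
    rw [mul_sum, mul_sum, hB, sum_filter, ← sum_add_distrib]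
    refine sum_le_sum fun v _ => ?_
    split_ifs with hv
    · nlinarith [lampPotential_le (colouring k v) S, sq_nonneg (f v)]
    · nlinarith [lampPotential_le_of_even (colouring k v) S hS hv, sq_nonneg (f v)]
  have hBsum : ∑ v ∈ B, f v ^ 2 ≤ 2 * B.card * m ^ 2 + 2 * ∑ v, h v ^ 2 := by
    have h1 : ∑ v ∈ B, f v ^ 2 ≤ ∑ v ∈ B, (2 * m ^ 2 + 2 * h v ^ 2) :=
      sum_le_sum fun v _ => by
        simp only [hh]; nlinarith [sq_nonneg (f v - m - m)]
    have h2 : ∑ v ∈ B, h v ^ 2 ≤ ∑ v, h v ^ 2 :=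
      sum_le_sum_of_subset_of_nonneg (subset_univ _) fun _ _ _ => sq_nonneg _
    rw [sum_add_distrib, sum_const, nsmul_eq_mul, ← mul_sum] at h1
    linarith
  have h9 : 0 ≤ ∑ v, h v ^ 2 := sum_nonneg fun _ _ => sq_nonneg _
  have h10 : 2 * B.card * m ^ 2 ≤ N * m ^ 2 / 8 := by nlinarith [sq_nonneg m]
  have h11 : 0 ≤ N * m ^ 2 := by positivity
  -- Beyond 4320 + 6 * 12 = 4392, the mean part costs at most 24/8 = 3 and the deviation 48 - 40.5 =
  -- 7.5; both are below 8.
  rw [sectorForm_self, hen]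
  have hgap' : 3 / 20 * ∑ v, h v ^ 2 ≤ expanderEnergy h := hgap
  linarith

/-- The `2 × 2` block form in one sector, for an eigenvalue `lam` of the block matrix with rows
`(p, ρ + 4404)` and `(ρ + 4404, -q)`. -/
theorem block_sectorForm_le (ρ lam κ p q : ℝ) (hρ : 4416 ≤ ρ) (hκ : 0 < κ)
    (hp3 : p ≤ 3) (hq3 : q ≤ 3)
    (h1 : p + (ρ + 4404) * κ = lam) (h2 : -q + (ρ + 4404) * κ⁻¹ = lam) (h3 : ρ + 4403 ≤ lam)
    (S : Fin k → ZMod 2) (A B : (Bool × Fin (2 * k) → ZMod 2) → ℝ)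
    (h0 : S = 0 → ∑ v, (A v + B v) = 0) :
    p * ∑ v, A v ^ 2 + q * signChar (∑ i, S i) * ∑ v, B v ^ 2 + 2 * sectorForm ρ S A B
      ≤ lam * (∑ v, A v ^ 2 + ∑ v, B v ^ 2) := by
  have hA : 0 ≤ ∑ v, A v ^ 2 := sum_nonneg fun _ _ => sq_nonneg _
  have hB : 0 ≤ ∑ v, B v ^ 2 := sum_nonneg fun _ _ => sq_nonneg _
  by_cases hS : ∑ i, S i = 0
  · rw [hS, signChar_zero, mul_one]
    -- The inner edges add at most 3, and ρ + 4400 + 3 ≤ `lam`.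
    suffices h : 2 * sectorForm ρ S A B ≤ (ρ + 4400) * (∑ v, A v ^ 2 + ∑ v, B v ^ 2) by
      nlinarith
    by_cases hS0 : S = 0
    · have hAB := h0 hS0
      rw [sum_add_distrib] at hAB
      set N : ℝ := ((Fintype.card (Bool × Fin (2 * k) → ZMod 2) : ℕ) : ℝ) with hN
      have hNpos : 0 < N := by
        rw [hN]; exact_mod_cast Fintype.card_pos
      set m : ℝ := (∑ v, A v) / N with hm
      have hmA : ∑ v, A v = N * m := by rw [hm]; field_simp
      have hmB : ∑ v, B v = -(N * m) := by linarith
      set A' : (Bool × Fin (2 * k) → ZMod 2) → ℝ := fun v => A v - m with hA'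
      set B' : (Bool × Fin (2 * k) → ZMod 2) → ℝ := fun v => B v + m with hB'
      have sA : ∑ v, A' v = 0 := by
        simp only [hA', sum_sub_distrib, hmA, sum_const, card_univ, nsmul_eq_mul, ← hN]
        ring
      have sB : ∑ v, B' v = 0 := by
        simp only [hB', sum_add_distrib, hmB, sum_const, card_univ, nsmul_eq_mul, ← hN]
        ring
      have qA : ∑ v, A v ^ 2 = N * m ^ 2 + ∑ v, A' v ^ 2 := by
        have e : ∀ v, A v ^ 2 = m ^ 2 + 2 * m * A' v + A' v ^ 2 := fun v => by
          simp only [hA']; ring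
        simp only [e, sum_add_distrib, ← mul_sum, sA, sum_const, card_univ, nsmul_eq_mul, ← hN]
        ring
      have qB : ∑ v, B v ^ 2 = N * m ^ 2 + ∑ v, B' v ^ 2 := by
        have e : ∀ v, B v ^ 2 = m ^ 2 - 2 * m * B' v + B' v ^ 2 := fun v => by
          simp only [hB']; ring
        simp only [e, sum_add_distrib, sum_sub_distrib, ← mul_sum, sB, sum_const, card_univ,
          nsmul_eq_mul, ← hN]
        ring
      have hpot : ∀ v, lampPotential (colouring k v) S = 16 := fun v => by
        simp [lampPotential, hS0, walshChar_zero_left]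
      -- The means of `A` and `B` are opposite, so the constant parts, which carry the top value ρ +
      -- 4416, enter with a negative sign.
      have hform : sectorForm ρ S A B = sectorForm ρ S A' B' - (ρ + 4416) * (N * m ^ 2) := by
        have e1 : ∀ w : (Bool × Fin (2 * k) → ZMod 2) → Bool × Fin (2 * k) → ZMod 2,
            (∑ v, B' (w v) = 0) → ∑ v, A v * B (w v) = ∑ v, A' v * B' (w v) - N * m ^ 2 := by
          intro w hw
          have e : ∀ v, A v * B (w v) = A' v * B' (w v) - m * A' v + m * B' (w v) - m ^ 2 :=
            fun v => by simp only [hA', hB']; ring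
          simp only [e, sum_add_distrib, sum_sub_distrib, ← mul_sum, sA, hw, sum_const,
            card_univ, nsmul_eq_mul, ← hN]
          ring
        have e2 := e1 id sB
        have e3 : ∀ g, ∑ v, A v * B (expanderMap (2 * k) g v)
            = ∑ v, A' v * B' (expanderMap (2 * k) g v) - N * m ^ 2 := fun g =>
          e1 _ (by rw [sum_expanderMap g B', sB])
        simp only [id] at e2
        simp only [sectorForm, hpot, ← mul_sum, e2, e3, sum_sub_distrib, sum_const, card_univ,
          Fintype.card_prod, Fintype.card_bool, Fintype.card_fin, nsmul_eq_mul]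
        push_cast
        ring
      have h4 := two_mul_sectorForm_le ρ hρ S 1 one_pos A' B'
      have h5 := sectorForm_le_of_sum_eq_zero ρ S A' sA
      have h6 := sectorForm_le_of_sum_eq_zero ρ S B' sB
      rw [hform, qA, qB]
      have h7 : 0 ≤ N * m ^ 2 := by positivity
      rw [inv_one] at h4
      nlinarith
    · have h4 := two_mul_sectorForm_le ρ hρ S 1 one_pos A B
      have h5 := sectorForm_le_of_even ρ S hS hS0 A
      have h6 := sectorForm_le_of_even ρ S hS hS0 B
      rw [inv_one] at h4
      linarith
  · have hS1 : ∑ i, S i = 1 := (zmod_two_eq_zero_or_one _).resolve_left hS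
    -- The weight κ is the ratio of the entries of the 2 × 2 eigenvector, so the bounds for `A` and
    -- `B` become exactly the two eigenvalue equations.
    have h4 := two_mul_sectorForm_le ρ hρ S κ hκ A B
    have h5 := mul_le_mul_of_nonneg_left (sectorForm_le_of_odd ρ S hS A) hκ.le
    have h6 := mul_le_mul_of_nonneg_left (sectorForm_le_of_odd ρ S hS B) (inv_pos.mpr hκ).le
    rw [hS1, signChar_one]
    have e1 : lam * ∑ v, A v ^ 2 = p * ∑ v, A v ^ 2 + κ * ((ρ + 4404) * ∑ v, A v ^ 2) := by
      rw [← h1]; ring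
    have e2 : lam * ∑ v, B v ^ 2 = -q * ∑ v, B v ^ 2 + κ⁻¹ * ((ρ + 4404) * ∑ v, B v ^ 2) := by
      rw [← h2]; ring
    linarith

end Sector

/-! ### Moves on positions and assembly of the sectors -/

section Switches

/-- Positions: a vertex of the expander together with a label. -/
abbrev Position (k : ℕ) : Type := (Bool × Fin (2 * k) → ZMod 2) × (Fin k → ZMod 2)

/-- Indices of the switches: `540` copies of each expander map and `6` copies of each lamp. -/
abbrev SwitchIndex : Type := ((Bool × Bool × Fin 2) × Fin 540) ⊕ (Fin 16 × Fin 6)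

variable {k : ℕ}

/-- A switch moves along the expander, or changes the label by a lamp vector. -/
noncomputable def switchMap : SwitchIndex → Position k → Position k
  | Sum.inl g, p => (expanderMap (2 * k) g.1 p.1, p.2)
  | Sum.inr l, p => (p.1, p.2 + lampVector (colouring k p.1) l.1)

theorem switchMap_involutive (i : SwitchIndex) :
    Function.Involutive (switchMap i : Position k → Position k) := by
  intro p
  rcases i with g | l
  · simp only [switchMap, expanderMap_involutive (2 * k) g.1 p.1]
  · simp only [switchMap, add_assoc, zmod_two_add_self, add_zero]

/-- The antipodal map on labels. -/
def flipLabel (p : Position k) : Position k := (p.1, p.2 + 1)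

theorem flipLabel_involutive : Function.Involutive (flipLabel : Position k → Position k) := by
  intro p
  simp only [flipLabel, add_assoc, zmod_two_add_self, add_zero]

theorem flipLabel_ne (hk : 0 < k) (p : Position k) : flipLabel p ≠ p := by
  intro h
  have h1 := congrFun (congrArg Prod.snd h) ⟨0, hk⟩
  simp [flipLabel] at h1

theorem sum_walshTransform_label (a b : Position k → ℝ) (v w : Bool × Fin (2 * k) → ZMod 2)
    (s : Fin k → ZMod 2) :
    2 ^ k * ∑ x, a (v, x) * b (w, x + s) = ∑ S, walshChar S s *
      walshTransform (fun x => a (v, x)) S * walshTransform (fun x => b (w, x)) S := by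
  rw [sum_walshTransform_mul, Fintype.card_fin]

theorem sum_fst_fin {α : Type*} [Fintype α] {n : ℕ} (F : α → ℝ) :
    ∑ x : α × Fin n, F x.1 = n * ∑ t, F t := by
  rw [Fintype.sum_prod_type, mul_sum]
  simp

/-- The form bound for functions of the position. -/
theorem position_form_le (ρ lam κ p q : ℝ) (hρ : 4416 ≤ ρ) (hκ : 0 < κ)
    (hp3 : p ≤ 3) (hq3 : q ≤ 3)
    (h1 : p + (ρ + 4404) * κ = lam) (h2 : -q + (ρ + 4404) * κ⁻¹ = lam) (h3 : ρ + 4403 ≤ lam)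
    (a b : Position k → ℝ) (h0 : ∑ x, (a x + b x) = 0) :
    p * ∑ x, a x ^ 2 + q * ∑ x, b x * b (flipLabel x)
      + 2 * (ρ * ∑ x, a x * b x + ∑ i, ∑ x, a x * b (switchMap i x))
      ≤ lam * (∑ x, a x ^ 2 + ∑ x, b x ^ 2) := by
  set A : (Fin k → ZMod 2) → (Bool × Fin (2 * k) → ZMod 2) → ℝ :=
    fun S v => walshTransform (fun x => a (v, x)) S with hA
  set B : (Fin k → ZMod 2) → (Bool × Fin (2 * k) → ZMod 2) → ℝ :=
    fun S v => walshTransform (fun x => b (v, x)) S with hB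
  have key := sum_le_sum (s := univ) fun S (_ : S ∈ univ) =>
    block_sectorForm_le ρ lam κ p q hρ hκ hp3 hq3 h1 h2 h3 S (A S) (B S) (by
      rintro rfl
      simp only [hA, hB, walshTransform, walshChar_zero_left, one_mul, ← sum_add_distrib]
      rw [← Fintype.sum_prod_type (fun x : Position k => a x + b x)]
      exact h0)
  have eA : 2 ^ k * ∑ x, a x ^ 2 = ∑ S, ∑ v, A S v ^ 2 := by
    rw [sum_comm, Fintype.sum_prod_type, mul_sum]
    refine sum_congr rfl fun v _ => ?_
    rw [hA, sum_walshTransform_sq, Fintype.card_fin]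
  have eB : 2 ^ k * ∑ x, b x ^ 2 = ∑ S, ∑ v, B S v ^ 2 := by
    rw [sum_comm, Fintype.sum_prod_type, mul_sum]
    refine sum_congr rfl fun v _ => ?_
    rw [hB, sum_walshTransform_sq, Fintype.card_fin]
  -- Adding the all-ones label multiplies the character of `S` by (-1)^|S|.
  have eF : 2 ^ k * ∑ x, b x * b (flipLabel x)
      = ∑ S, signChar (∑ i, S i) * ∑ v, B S v ^ 2 := by
    simp only [mul_sum]
    rw [sum_comm, Fintype.sum_prod_type]
    refine sum_congr rfl fun v _ => ?_
    rw [← mul_sum]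
    simp only [flipLabel]
    rw [sum_walshTransform_label]
    refine sum_congr rfl fun S _ => ?_
    rw [walshChar, dotProduct_one]
    simp only [hB]; ring
  have eI : 2 ^ k * ∑ x, a x * b x = ∑ S, ∑ v, A S v * B S v := by
    rw [sum_comm, Fintype.sum_prod_type, mul_sum]
    refine sum_congr rfl fun v _ => ?_
    have h := sum_walshTransform_label a b v v 0
    simpa only [add_zero, walshChar_zero_right, one_mul] using h
  have eE : ∀ g : (Bool × Bool × Fin 2), 2 ^ k * ∑ x : Position k, a x *
      b (expanderMap (2 * k) g x.1, x.2)
      = ∑ S, ∑ v, A S v * B S (expanderMap (2 * k) g v) := by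
    intro g
    rw [sum_comm, Fintype.sum_prod_type, mul_sum]
    refine sum_congr rfl fun v _ => ?_
    have h := sum_walshTransform_label a b v (expanderMap (2 * k) g v) 0
    simpa only [add_zero, walshChar_zero_right, one_mul] using h
  have eL : ∀ l : Fin 16, 2 ^ k * ∑ x : Position k, a x *
      b (x.1, x.2 + lampVector (colouring k x.1) l)
      = ∑ S, ∑ v, walshChar S (lampVector (colouring k v) l) * (A S v * B S v) := by
    intro l
    rw [sum_comm, Fintype.sum_prod_type, mul_sum]
    refine sum_congr rfl fun v _ => ?_
    have h := sum_walshTransform_label a b v v (lampVector (colouring k v) l)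
    simpa only [mul_assoc] using h
  have eS : 2 ^ k * ∑ i, ∑ x, a x * b (switchMap i x)
      = ∑ S, (540 * ∑ g, ∑ v, A S v * B S (expanderMap (2 * k) g v)
        + 6 * ∑ v, lampPotential (colouring k v) S * (A S v * B S v)) := by
    rw [Fintype.sum_sum_type, mul_add, sum_add_distrib]
    simp only [switchMap]
    rw [sum_fst_fin fun g => ∑ x : Position k, a x * b (expanderMap (2 * k) g x.1, x.2),
      sum_fst_fin fun l => ∑ x : Position k, a x * b (x.1, x.2 + lampVector (colouring k x.1) l)]
    congr 1
    · rw [mul_left_comm, mul_sum (a := (2 : ℝ) ^ k)]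
      simp only [eE, ← mul_sum]
      rw [sum_comm]
      norm_num
    · rw [mul_left_comm, mul_sum (a := (2 : ℝ) ^ k)]
      simp only [eL, ← mul_sum]
      rw [sum_comm]
      norm_num
      refine sum_congr rfl fun S _ => ?_
      rw [sum_comm]
      simp only [lampPotential, sum_mul]
  have hpos : (0 : ℝ) < 2 ^ k := by positivity
  refine le_of_mul_le_mul_left ?_ hpos
  have hL : 2 ^ k * (p * ∑ x, a x ^ 2 + q * ∑ x, b x * b (flipLabel x)
      + 2 * (ρ * ∑ x, a x * b x + ∑ i, ∑ x, a x * b (switchMap i x)))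
      = ∑ S, (p * ∑ v, A S v ^ 2 + q * signChar (∑ i, S i) * ∑ v, B S v ^ 2
        + 2 * sectorForm ρ S (A S) (B S)) := by
    have e : ∀ S, p * ∑ v, A S v ^ 2 + q * signChar (∑ i, S i) * ∑ v, B S v ^ 2
        + 2 * sectorForm ρ S (A S) (B S)
        = p * ∑ v, A S v ^ 2 + q * (signChar (∑ i, S i) * ∑ v, B S v ^ 2)
          + 2 * (ρ * ∑ v, A S v * B S v
            + (540 * ∑ g, ∑ v, A S v * B S (expanderMap (2 * k) g v)
        + 6 * ∑ v, lampPotential (colouring k v) S * (A S v * B S v))) := fun S => by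
      rw [sectorForm]; ring
    rw [sum_congr rfl fun S _ => e S, sum_add_distrib, sum_add_distrib, ← mul_sum, ← mul_sum,
      ← mul_sum, sum_add_distrib, ← mul_sum, ← eA, ← eF, ← eI, ← eS]
    ring
  have hR : 2 ^ k * (lam * (∑ x, a x ^ 2 + ∑ x, b x ^ 2))
      = ∑ S, lam * (∑ v, A S v ^ 2 + ∑ v, B S v ^ 2) := by
    rw [← mul_sum, sum_add_distrib, ← eA, ← eB]; ring
  rw [hL, hR]
  exact key

end Switches

/-! ### Splitting functions into fibre averages and deviations -/

section Fibre

variable {Y : Type*} [Fintype Y]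

/-- The average over the fibre. -/
noncomputable def fibreMean {P : Type*} (a : P × Y → ℝ) (p : P) : ℝ :=
  (∑ y, a (p, y)) / Fintype.card Y

/-- The deviation from the average over the fibre. -/
noncomputable def fibreDev {P : Type*} (a : P × Y → ℝ) (x : P × Y) : ℝ := a x - fibreMean a x.1

theorem sum_fibreDev [Nonempty Y] {P : Type*} (a : P × Y → ℝ) (p : P) : ∑ y, fibreDev a (p, y) = 0 := by
  have h : (Fintype.card Y : ℝ) ≠ 0 := by exact_mod_cast Fintype.card_ne_zero
  simp only [fibreDev, fibreMean, sum_sub_distrib, sum_const, card_univ, nsmul_eq_mul]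
  field_simp
  ring

/-- The cross terms vanish: `θ` permutes the fibre, so deviations still sum to zero after it. -/
theorem sum_mul_split [Nonempty Y] {P : Type*} [Fintype P] (a b : P × Y → ℝ) (π : P → P) (θ : Equiv.Perm Y) :
    ∑ x : P × Y, a x * b (π x.1, θ x.2)
      = Fintype.card Y * ∑ p, fibreMean a p * fibreMean b (π p)
        + ∑ x : P × Y, fibreDev a x * fibreDev b (π x.1, θ x.2) := by
  rw [Fintype.sum_prod_type, Fintype.sum_prod_type, mul_sum, ← sum_add_distrib]
  refine sum_congr rfl fun p _ => ?_
  have e : ∀ y, a (p, y) * b (π p, θ y) = fibreDev a (p, y) * fibreDev b (π p, θ y)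
      + fibreMean b (π p) * fibreDev a (p, y) + fibreMean a p * fibreDev b (π p, θ y)
      + fibreMean a p * fibreMean b (π p) := fun y => by
    simp only [fibreDev]; ring
  have h2 : ∑ y, fibreDev b (π p, θ y) = 0 := by
    rw [Equiv.sum_comp θ fun y => fibreDev b (π p, y), sum_fibreDev]
  simp only [e, sum_add_distrib, ← mul_sum, sum_fibreDev, h2, sum_const, card_univ, nsmul_eq_mul]
  ring

theorem sum_sq_split [Nonempty Y] {P : Type*} [Fintype P] (a : P × Y → ℝ) :
    ∑ x, a x ^ 2 = Fintype.card Y * ∑ p, fibreMean a p ^ 2 + ∑ x, fibreDev a x ^ 2 := by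
  have h := sum_mul_split a a id (Equiv.refl Y)
  simpa [← pow_two] using h

theorem two_mul_sum_mul_le {P : Type*} [Fintype P] (a b : P × Y → ℝ) (π : P → P)
    (hπ : Function.Involutive π) (θ : Equiv.Perm Y) :
    2 * ∑ x : P × Y, a x * b (π x.1, θ x.2) ≤ ∑ x, a x ^ 2 + ∑ x, b x ^ 2 := by
  have h : ∑ x : P × Y, b (π x.1, θ x.2) ^ 2 = ∑ x, b x ^ 2 :=
    Equiv.sum_comp (Equiv.prodCongr hπ.toPerm θ) fun x => b x ^ 2
  rw [← h, mul_sum, ← sum_add_distrib]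
  exact sum_le_sum fun x _ => by nlinarith [sq_nonneg (a x - b (π x.1, θ x.2))]

end Fibre

/-! ### The graph, its eigenvectors and its form bound -/

section Graph

variable {k r : ℕ} {Y : Type*}

/-- The map on positions attached to `d : Y`: a switch, or the identity. -/
noncomputable def switchAt (e : Y ≃ SwitchIndex ⊕ Fin r) (d : Y) : Position k → Position k :=
  Sum.elim switchMap (fun _ => id) (e d)

theorem switchAt_involutive (e : Y ≃ SwitchIndex ⊕ Fin r) (d : Y) :
    Function.Involutive (switchAt e d : Position k → Position k) := by
  unfold switchAt
  rcases e d with i | i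
  · exact switchMap_involutive i
  · exact fun _ => rfl

theorem sum_switchAt [Fintype Y] (e : Y ≃ SwitchIndex ⊕ Fin r) (F : (Position k → Position k) → ℝ) :
    ∑ d, F (switchAt e d) = ∑ i, F (switchMap i) + r * F id := by
  simp only [switchAt]
  rw [Equiv.sum_comp e fun s => F (Sum.elim switchMap (fun _ => id) s), Fintype.sum_sum_type]
  simp

/-- The eigenvector attached to the label coordinate `i`. -/
noncomputable def labelVector (κ : ℝ) (i : Fin k) : (Position k × Y) ⊕ (Position k × Y) → ℝ
  | Sum.inl x => signChar (x.1.2 i)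
  | Sum.inr x => κ * signChar (x.1.2 i)

/-- Comparing a relation at the labels 0 and e_i isolates the coefficient of index `i`. -/
theorem linearIndependent_labelVector [Nonempty Y] (κ : ℝ) :
    LinearIndependent ℝ (fun i : Fin k => (labelVector κ i :
      (Position k × Y) ⊕ (Position k × Y) → ℝ)) := by
  rw [Fintype.linearIndependent_iff]
  intro g hg i
  have h : ∀ x : Fin k → ZMod 2, ∑ j, g j * signChar (x j) = 0 := fun x => by
    have := congrFun hg (Sum.inl ((0, x), Classical.arbitrary Y))
    simpa [labelVector] using this
  have h0 := h 0
  have h1 := h (Pi.single i 1)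
  have h2 : ∑ j, g j * (signChar ((0 : Fin k → ZMod 2) j)
      - signChar ((Pi.single i 1 : Fin k → ZMod 2) j)) = 0 := by
    simp only [mul_sub, sum_sub_distrib, h0, h1, sub_zero]
  rw [Fintype.sum_eq_single i] at h2
  · rw [Pi.zero_apply, Pi.single_eq_same, signChar_zero, signChar_one] at h2
    linarith
  · intro j hj
    simp [hj]

theorem sum_signChar_switchAt [Fintype Y] (e : Y ≃ SwitchIndex ⊕ Fin r) (p : Position k) (i : Fin k) :
    ∑ d, signChar ((switchAt e d p).2 i) = (r + 4404) * signChar (p.2 i) := by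
  rw [sum_switchAt e fun σ => signChar ((σ p).2 i), Fintype.sum_sum_type]
  have h := lampPotential_single (colouring k p.1) i
  have h2 : ∀ l, walshChar (Pi.single i 1) (lampVector (colouring k p.1) l)
      = signChar (lampVector (colouring k p.1) l i) := fun l => by
    rw [walshChar, single_dotProduct, one_mul]
  simp only [lampPotential, h2] at h
  simp only [switchMap, Pi.add_apply, signChar_add, ← mul_sum]
  rw [sum_fst_fin fun l => signChar (lampVector (colouring k p.1) l i), h]
  simp only [sum_const, card_univ, Fintype.card_fin, Fintype.card_prod, Fintype.card_bool,
    nsmul_eq_mul, id]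
  push_cast
  ring

variable [AddCommGroup Y] [Fintype Y]

open Classical in
theorem sum_ite_switch (e : Y ≃ SwitchIndex ⊕ Fin r) (p : Position k) (y : Y) (F : Position k × Y → ℝ) :
    (∑ w : Position k × Y, if w.1 = switchAt e (y + w.2) p then F w else 0)
      = ∑ d, F (switchAt e d p, d - y) := by
  rw [Fintype.sum_prod_type_right, ← Equiv.sum_comp (Equiv.subRight y)]
  refine sum_congr rfl fun d _ => ?_
  simp

/-- The contribution of the fibre deviations to the edges between the two copies. -/
theorem sum_fibreDev_switchAt_le (e : Y ≃ SwitchIndex ⊕ Fin r) (a b : Position k × Y → ℝ) :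
    ∑ d, ∑ x : Position k × Y, fibreDev a x * fibreDev b (switchAt e d x.1, d - x.2)
      ≤ 4416 * (∑ x, fibreDev a x ^ 2 + ∑ x, fibreDev b x ^ 2) := by
  -- Each move is compared with the identity. If all moves were the identity, the sum over `d` would
  -- run through whole fibres and vanish; so only the 4416 genuine switches contribute, whatever `r`
  -- is.
  set T : Y → ℝ := fun d => ∑ x : Position k × Y,
    fibreDev a x * fibreDev b (switchAt e d x.1, d - x.2)
      - ∑ x : Position k × Y, fibreDev a x * fibreDev b (x.1, d - x.2) with hT
  have h0 : ∑ d, ∑ x : Position k × Y, fibreDev a x * fibreDev b (x.1, d - x.2) = 0 := by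
    rw [sum_comm]
    refine sum_eq_zero fun x _ => ?_
    have h := Equiv.sum_comp (Equiv.subRight x.2) fun z => fibreDev b (x.1, z)
    simp only [Equiv.subRight_apply] at h
    rw [← mul_sum, h, sum_fibreDev, mul_zero]
  have h1 : ∑ d, ∑ x : Position k × Y, fibreDev a x * fibreDev b (switchAt e d x.1, d - x.2)
      = ∑ d, T d := by
    simp only [hT, sum_sub_distrib, h0, sub_zero]
  rw [h1, ← Equiv.sum_comp e.symm, Fintype.sum_sum_type]
  have h2 : ∀ i : Fin r, T (e.symm (Sum.inr i)) = 0 := fun i => by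
    simp [hT, switchAt]
  have h3 : ∀ d, T d ≤ ∑ x, fibreDev a x ^ 2 + ∑ x, fibreDev b x ^ 2 := fun d => by
    have e1 := two_mul_sum_mul_le (fibreDev a) (fibreDev b) (switchAt e d)
      (switchAt_involutive e d) (Equiv.subLeft d)
    have e2 := two_mul_sum_mul_le (fun x => - fibreDev a x) (fibreDev b) (id : Position k → _)
      (fun _ => rfl) (Equiv.subLeft d)
    simp only [Equiv.subLeft_apply, id, neg_mul, sum_neg_distrib, neg_sq] at e1 e2
    simp only [hT]
    linarith
  simp only [h2, sum_const_zero, add_zero]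
  refine (sum_le_sum fun i _ => h3 _).trans ?_
  rw [sum_const, nsmul_eq_mul]
  simp

variable [DecidableEq Y]

/-- The graph: two copies of `Position k × Y`, joined through the switches, with edges inside the
first copy given by `Da` and edges inside the second copy given by `Db` and the label flip. -/
def switchGraph (hk : 0 < k) (e : Y ≃ SwitchIndex ⊕ Fin r) (Da Db : Finset Y)
    (ha : ∀ d ∈ Da, -d ∈ Da) (ha0 : (0 : Y) ∉ Da) (hb : ∀ d ∈ Db, -d ∈ Db) :
    SimpleGraph ((Position k × Y) ⊕ (Position k × Y)) where
  Adj
    | Sum.inl a, Sum.inl b => b.1 = a.1 ∧ b.2 - a.2 ∈ Da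
    -- The sum of the `Y`-coordinates is symmetric and separates coinciding moves, so no multiple
    -- edges arise.
    | Sum.inl a, Sum.inr b => b.1 = switchAt e (a.2 + b.2) a.1
    | Sum.inr a, Sum.inl b => a.1 = switchAt e (b.2 + a.2) b.1
    | Sum.inr a, Sum.inr b => b.1 = flipLabel a.1 ∧ b.2 - a.2 ∈ Db
  symm := ⟨by
    rintro (a | a) (b | b) h
    · exact ⟨h.1.symm, by simpa using ha _ h.2⟩
    · exact h
    · exact h
    · exact ⟨by rw [h.1, flipLabel_involutive], by simpa using hb _ h.2⟩⟩
  loopless := ⟨by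
    rintro (a | a) h
    · exact ha0 (by simpa using h.2)
    · exact flipLabel_ne hk a.1 h.1.symm⟩

open Classical in
/-- The sum of a function over the neighbours of a vertex. -/
noncomputable def neighborSum {V : Type*} [Fintype V] (G : SimpleGraph V) (f : V → ℝ) (u : V) :
    ℝ :=
  ∑ w, if G.Adj u w then f w else 0

variable (hk : 0 < k) (e : Y ≃ SwitchIndex ⊕ Fin r) (Da Db : Finset Y)
    (ha : ∀ d ∈ Da, -d ∈ Da) (ha0 : (0 : Y) ∉ Da) (hb : ∀ d ∈ Db, -d ∈ Db)

theorem sum_ite_sub_mem (D : Finset Y) (y : Y) (F : Y → ℝ) :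
    (∑ z, if z - y ∈ D then F z else 0) = ∑ d ∈ D, F (y + d) := by
  rw [← Equiv.sum_comp (Equiv.addLeft y), ← sum_filter]
  simp

theorem neighborSum_inl (f : (Position k × Y) ⊕ (Position k × Y) → ℝ) (p : Position k) (y : Y) :
    neighborSum (switchGraph hk e Da Db ha ha0 hb) f (Sum.inl (p, y))
      = ∑ d ∈ Da, f (Sum.inl (p, y + d)) + ∑ d, f (Sum.inr (switchAt e d p, d - y)) := by
  classical
  rw [neighborSum, Fintype.sum_sum_type]
  congr 1
  · rw [Fintype.sum_prod_type, Fintype.sum_eq_single p]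
    · rw [← sum_ite_sub_mem Da y fun z => f (Sum.inl (p, z))]
      simp [switchGraph]
    · intro p' hp'
      simp [switchGraph, hp']
  · rw [← sum_ite_switch e p y fun w => f (Sum.inr w)]
    exact sum_congr rfl fun w _ => if_congr Iff.rfl rfl rfl

theorem neighborSum_inr (f : (Position k × Y) ⊕ (Position k × Y) → ℝ) (p : Position k) (y : Y) :
    neighborSum (switchGraph hk e Da Db ha ha0 hb) f (Sum.inr (p, y))
      = ∑ d, f (Sum.inl (switchAt e d p, d - y))
        + ∑ d ∈ Db, f (Sum.inr (flipLabel p, y + d)) := by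
  classical
  rw [neighborSum, Fintype.sum_sum_type]
  congr 1
  · rw [← sum_ite_switch e p y fun w => f (Sum.inl w)]
    refine sum_congr rfl fun w _ => ?_
    have h : (p = switchAt e (w.2 + y) w.1) ↔ w.1 = switchAt e (y + w.2) p := by
      rw [add_comm y]
      constructor
      · intro h; rw [h, switchAt_involutive]
      · intro h; rw [h, switchAt_involutive]
    exact if_congr h rfl rfl
  · rw [Fintype.sum_prod_type, Fintype.sum_eq_single (flipLabel p)]
    · rw [← sum_ite_sub_mem Db y fun z => f (Sum.inr (flipLabel p, z))]
      simp [switchGraph]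
    · intro p' hp'
      simp [switchGraph, hp']

/-- The form bound for the graph. -/
theorem switchGraph_form_le (lam κ : ℝ) (hr : 4416 ≤ r) (hκ : 0 < κ)
    (hDa : Da.card ≤ 3) (hDb : Db.card ≤ 3) (h1 : Da.card + ((r : ℝ) + 4404) * κ = lam)
    (h2 : -(Db.card : ℝ) + ((r : ℝ) + 4404) * κ⁻¹ = lam) (h3 : (r : ℝ) + 4403 ≤ lam)
    (h4 : 8835 ≤ lam)
    (f : (Position k × Y) ⊕ (Position k × Y) → ℝ) (hf : ∑ u, f u = 0) :
    ∑ u, f u * neighborSum (switchGraph hk e Da Db ha ha0 hb) f u ≤ lam * ∑ u, f u ^ 2 := by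
  set a : Position k × Y → ℝ := fun x => f (Sum.inl x) with ha'
  set b : Position k × Y → ℝ := fun x => f (Sum.inr x) with hb'
  set m : ℝ := ((Fintype.card Y : ℕ) : ℝ) with hm
  have hmpos : 0 < m := by rw [hm]; exact_mod_cast Fintype.card_pos
  set Na : ℝ := ∑ x, fibreDev a x ^ 2 with hNa
  set Nb : ℝ := ∑ x, fibreDev b x ^ 2 with hNb
  have hNa0 : 0 ≤ Na := sum_nonneg fun _ _ => sq_nonneg _
  have hNb0 : 0 ≤ Nb := sum_nonneg fun _ _ => sq_nonneg _
  have hC : ∑ d, ∑ x : Position k × Y, a x * b (switchAt e d x.1, d - x.2)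
      ≤ m * (∑ p, ∑ d, fibreMean a p * fibreMean b (switchAt e d p)) + 4416 * (Na + Nb) := by
    have e1 : ∀ d, ∑ x : Position k × Y, a x * b (switchAt e d x.1, d - x.2)
        = m * ∑ p, fibreMean a p * fibreMean b (switchAt e d p)
          + ∑ x : Position k × Y, fibreDev a x * fibreDev b (switchAt e d x.1, d - x.2) :=
      fun d => by
        have := sum_mul_split a b (switchAt e d) (Equiv.subLeft d)
        simpa only [Equiv.subLeft_apply] using this
    rw [sum_congr rfl fun d _ => e1 d, sum_add_distrib, ← mul_sum,
      sum_comm (s := univ (α := Y)) (t := univ (α := Position k))]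
    have := sum_fibreDev_switchAt_le e a b
    linarith
  have hA : ∑ d ∈ Da, ∑ x : Position k × Y, a x * a (x.1, x.2 + d)
      ≤ m * (Da.card * ∑ p, fibreMean a p ^ 2) + 3 * Na := by
    have e1 : ∀ d, ∑ x : Position k × Y, a x * a (x.1, x.2 + d)
        ≤ m * (∑ p, fibreMean a p ^ 2) + Na := fun d => by
      have e2 := sum_mul_split a a id (Equiv.addRight d)
      have e3 := two_mul_sum_mul_le (fibreDev a) (fibreDev a) (id : Position k → _)
        (fun _ => rfl) (Equiv.addRight d)
      simp only [Equiv.coe_addRight, id, ← pow_two] at e2 e3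
      linarith
    refine (sum_le_sum fun d _ => e1 d).trans ?_
    rw [sum_const, nsmul_eq_mul]
    have h5 : (Da.card : ℝ) ≤ 3 := by exact_mod_cast hDa
    nlinarith
  have hB : ∑ d ∈ Db, ∑ x : Position k × Y, b x * b (flipLabel x.1, x.2 + d)
      ≤ m * (Db.card * ∑ p, fibreMean b p * fibreMean b (flipLabel p)) + 3 * Nb := by
    have e1 : ∀ d, ∑ x : Position k × Y, b x * b (flipLabel x.1, x.2 + d)
        ≤ m * (∑ p, fibreMean b p * fibreMean b (flipLabel p)) + Nb := fun d => by
      have e2 := sum_mul_split b b flipLabel (Equiv.addRight d)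
      have e3 := two_mul_sum_mul_le (fibreDev b) (fibreDev b) flipLabel
        flipLabel_involutive (Equiv.addRight d)
      simp only [Equiv.coe_addRight] at e2 e3
      linarith
    refine (sum_le_sum fun d _ => e1 d).trans ?_
    rw [sum_const, nsmul_eq_mul]
    have h5 : (Db.card : ℝ) ≤ 3 := by exact_mod_cast hDb
    nlinarith
  have hform : ∑ u, f u * neighborSum (switchGraph hk e Da Db ha ha0 hb) f u
      = ∑ d ∈ Da, ∑ x : Position k × Y, a x * a (x.1, x.2 + d)
        + ∑ d ∈ Db, ∑ x : Position k × Y, b x * b (flipLabel x.1, x.2 + d)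
        + 2 * ∑ d, ∑ x : Position k × Y, a x * b (switchAt e d x.1, d - x.2) := by
    have e1 : ∀ d, ∑ x : Position k × Y, b x * a (switchAt e d x.1, d - x.2)
        = ∑ x : Position k × Y, a x * b (switchAt e d x.1, d - x.2) := fun d => by
      rw [← Equiv.sum_comp (Equiv.prodCongr (switchAt_involutive e d).toPerm (Equiv.subLeft d))]
      refine sum_congr rfl fun x _ => ?_
      change b (switchAt e d x.1, d - x.2) *
        a (switchAt e d (switchAt e d x.1), d - (d - x.2)) = _
      rw [switchAt_involutive, sub_sub_cancel, mul_comm]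
    rw [Fintype.sum_sum_type]
    have e2 : ∀ x : Position k × Y, f (Sum.inl x) *
        neighborSum (switchGraph hk e Da Db ha ha0 hb) f (Sum.inl x)
        = ∑ d ∈ Da, a x * a (x.1, x.2 + d) + ∑ d, a x * b (switchAt e d x.1, d - x.2) :=
      fun x => by rw [neighborSum_inl, mul_add, mul_sum, mul_sum]
    have e3 : ∀ x : Position k × Y, f (Sum.inr x) *
        neighborSum (switchGraph hk e Da Db ha ha0 hb) f (Sum.inr x)
        = ∑ d, b x * a (switchAt e d x.1, d - x.2)
          + ∑ d ∈ Db, b x * b (flipLabel x.1, x.2 + d) :=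
      fun x => by rw [neighborSum_inr, mul_add, mul_sum, mul_sum]
    rw [sum_congr rfl fun x _ => e2 x, sum_congr rfl fun x _ => e3 x, sum_add_distrib,
      sum_add_distrib]
    have c1 : ∑ x, ∑ d ∈ Da, a x * a (x.1, x.2 + d) = ∑ d ∈ Da, ∑ x, a x * a (x.1, x.2 + d) :=
      sum_comm
    have c2 : ∑ x, ∑ d, a x * b (switchAt e d x.1, d - x.2)
        = ∑ d, ∑ x, a x * b (switchAt e d x.1, d - x.2) := sum_comm
    have c3 : ∑ x, ∑ d, b x * a (switchAt e d x.1, d - x.2)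
        = ∑ d, ∑ x, a x * b (switchAt e d x.1, d - x.2) :=
      sum_comm.trans (sum_congr rfl fun d _ => e1 d)
    have c4 : ∑ x, ∑ d ∈ Db, b x * b (flipLabel x.1, x.2 + d)
        = ∑ d ∈ Db, ∑ x, b x * b (flipLabel x.1, x.2 + d) := sum_comm
    rw [c1, c2, c3, c4]
    ring
  have hsw : ∑ p, ∑ d, fibreMean a p * fibreMean b (switchAt e d p)
      = r * ∑ p, fibreMean a p * fibreMean b p
        + ∑ i, ∑ p, fibreMean a p * fibreMean b (switchMap i p) := by
    rw [sum_comm (s := univ (α := SwitchIndex)), mul_sum, ← sum_add_distrib]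
    refine sum_congr rfl fun p _ => ?_
    rw [sum_switchAt e fun σ => fibreMean a p * fibreMean b (σ p)]
    simp only [id]; ring
  have hmean : ∑ p, (fibreMean a p + fibreMean b p) = 0 := by
    rw [Fintype.sum_sum_type] at hf
    have e1 : ∑ p, ∑ y, a (p, y) = ∑ x, f (Sum.inl x) := (Fintype.sum_prod_type _).symm
    have e2 : ∑ p, ∑ y, b (p, y) = ∑ x, f (Sum.inr x) := (Fintype.sum_prod_type _).symm
    simp only [fibreMean, ← add_div, ← sum_div, sum_add_distrib]
    rw [e1, e2, hf, zero_div]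
  have hP := position_form_le (r : ℝ) lam κ Da.card Db.card (by exact_mod_cast hr) hκ
    (by exact_mod_cast hDa) (by exact_mod_cast hDb) h1 h2 h3 (fibreMean a) (fibreMean b) hmean
  have hP' := mul_le_mul_of_nonneg_left hP hmpos.le
  have hnorm : ∑ u, f u ^ 2 = m * ∑ p, fibreMean a p ^ 2 + Na
      + (m * ∑ p, fibreMean b p ^ 2 + Nb) := by
    rw [Fintype.sum_sum_type]
    have e1 := sum_sq_split a
    have e2 := sum_sq_split b
    simp only [ha', hb'] at e1 e2
    rw [e1, e2]
  rw [hform, hnorm]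
  rw [hsw] at hC
  -- On deviations the form is at most 2 * 4416 + 3 = 8835 times the squared norm.
  nlinarith [mul_nonneg (sub_nonneg.mpr h4) hNa0, mul_nonneg (sub_nonneg.mpr h4) hNb0]

/-- The character of one coordinate is scaled by r + 4404 across the copies and negated by the label
flip, so only the 2 × 2 eigenvector equations for (1, κ) remain. -/
theorem neighborSum_labelVector (lam κ : ℝ) (hκ : 0 < κ)
    (h1 : Da.card + ((r : ℝ) + 4404) * κ = lam)
    (h2 : -(Db.card : ℝ) + ((r : ℝ) + 4404) * κ⁻¹ = lam) (i : Fin k)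
    (u : (Position k × Y) ⊕ (Position k × Y)) :
    neighborSum (switchGraph hk e Da Db ha ha0 hb) (labelVector κ i) u
      = lam * labelVector κ i u := by
  rcases u with ⟨p, y⟩ | ⟨p, y⟩
  · rw [neighborSum_inl]
    simp only [labelVector, sum_const, nsmul_eq_mul, ← mul_sum, sum_signChar_switchAt]
    rw [← h1]; ring
  · rw [neighborSum_inr]
    simp only [labelVector, sum_const, nsmul_eq_mul, sum_signChar_switchAt, flipLabel,
      Pi.add_apply, Pi.one_apply, signChar_add, signChar_one]
    rw [← h2]
    field_simp
    ring

theorem neighborSum_one_inl (p : Position k) (y : Y) :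
    neighborSum (switchGraph hk e Da Db ha ha0 hb) (fun _ => 1) (Sum.inl (p, y))
      = Da.card + Fintype.card Y := by
  rw [neighborSum_inl]; simp

theorem neighborSum_one_inr (p : Position k) (y : Y) :
    neighborSum (switchGraph hk e Da Db ha ha0 hb) (fun _ => 1) (Sum.inr (p, y))
      = Fintype.card Y + Db.card := by
  rw [neighborSum_inr]; simp

end Graph

/-! ### From form bounds to second eigenvalue, connectedness and multiplicity -/

section Criterion

variable {V : Type*} [Fintype V]

theorem adjMatrix_mulVec_eq_neighborSum (G : SimpleGraph V) [DecidableRel G.Adj] (f : V → ℝ)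
    (u : V) : (G.adjMatrix ℝ).mulVec f u = neighborSum G f u := by
  classical
  rw [Matrix.mulVec, dotProduct, neighborSum]
  refine sum_congr rfl fun w _ => ?_
  by_cases h : G.Adj u w <;> simp [SimpleGraph.adjMatrix_apply, h]

theorem sum_mul_neighborSum_comm (G : SimpleGraph V) (f g : V → ℝ) :
    ∑ u, f u * neighborSum G g u = ∑ u, g u * neighborSum G f u := by
  classical
  simp only [neighborSum, mul_sum]
  rw [sum_comm]
  refine sum_congr rfl fun w _ => sum_congr rfl fun u _ => ?_
  rw [mul_ite, mul_ite, mul_zero, mul_zero, mul_comm]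
  exact if_congr (G.adj_comm _ _) rfl rfl

theorem neighborSum_linear (G : SimpleGraph V) (s t : ℝ) (f g : V → ℝ) (u : V) :
    neighborSum G (fun w => s * f w + t * g w) u
      = s * neighborSum G f u + t * neighborSum G g u := by
  classical
  simp only [neighborSum, mul_sum, ← sum_add_distrib]
  refine sum_congr rfl fun w _ => ?_
  split_ifs <;> simp

theorem card_le_eigenvalueMultiplicity [DecidableEq V] (G : SimpleGraph V) [DecidableRel G.Adj]
    (lam : ℝ) {k : ℕ} (f : Fin k → V → ℝ) (hf : LinearIndependent ℝ f)
    (heig : ∀ i u, neighborSum G (f i) u = lam * f i u) :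
    k ≤ eigenvalueMultiplicity G lam := by
  have hmem : ∀ i, f i ∈ Module.End.eigenspace (Matrix.toLin' (G.adjMatrix ℝ)) lam := by
    intro i
    rw [Module.End.mem_eigenspace_iff, Matrix.toLin'_apply]
    funext u
    rw [adjMatrix_mulVec_eq_neighborSum, heig]
    simp
  have hli : LinearIndependent ℝ (fun i => (⟨f i, hmem i⟩ :
      Module.End.eigenspace (Matrix.toLin' (G.adjMatrix ℝ)) lam)) := by
    apply LinearIndependent.of_comp (Submodule.subtype _)
    exact hf
  simpa [eigenvalueMultiplicity] using hli.fintype_card_le_finrank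

/-- A form bound on the functions of sum zero, together with multiplicity at least two, determines
the second eigenvalue. -/
theorem hasSecondEigenvalue_of_form_le [DecidableEq V] (G : SimpleGraph V) [DecidableRel G.Adj]
    (lam : ℝ)
    (hform : ∀ f : V → ℝ, ∑ u, f u = 0 → ∑ u, f u * neighborSum G f u ≤ lam * ∑ u, f u ^ 2)
    (hmult : 2 ≤ eigenvalueMultiplicity G lam) : HasSecondEigenvalue G lam := by
  have hcard : 1 < Fintype.card V := by
    have h := Submodule.finrank_le (Module.End.eigenspace (Matrix.toLin' (G.adjMatrix ℝ)) lam)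
    rw [Module.finrank_pi] at h
    rw [eigenvalueMultiplicity] at hmult
    omega
  refine ⟨hcard, ?_⟩
  set hA := G.adjMatrix_real_isHermitian with hA_def
  set ε : Fin (Fintype.card V) ≃ V := Fintype.equivOfCardEq (Fintype.card_fin _) with hε
  have hev : ∀ a, hA.eigenvalues (ε a) = hA.eigenvalues₀ a := fun a => by
    rw [Matrix.IsHermitian.eigenvalues, ← hε, Equiv.symm_apply_apply]
  set v : V → V → ℝ := fun j => (hA.eigenvectorBasis j).ofLp with hv
  have hAv : ∀ j u, neighborSum G (v j) u = hA.eigenvalues j * v j u := by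
    intro j u
    have h := congrFun (hA.mulVec_eigenvectorBasis j) u
    rw [adjMatrix_mulVec_eq_neighborSum] at h
    simpa using h
  have horth : ∀ i j, ∑ u, v i u * v j u = if i = j then 1 else 0 := by
    intro i j
    have h := orthonormal_iff_ite.mp hA.eigenvectorBasis.orthonormal i j
    rw [EuclideanSpace.inner_eq_star_dotProduct] at h
    rw [← h]
    simp [dotProduct, hv, mul_comm]
  set e0 := hA.eigenvalues₀ ⟨0, by omega⟩ with he0
  set e1 := hA.eigenvalues₀ ⟨1, hcard⟩ with he1
  have h01 : e1 ≤ e0 := hA.eigenvalues₀_antitone (Fin.mk_le_mk.mpr (Nat.zero_le 1))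
  set v0 := v (ε ⟨0, by omega⟩) with hv0
  set v1 := v (ε ⟨1, hcard⟩) with hv1
  apply le_antisymm
  · by_contra hlt
    push Not at hlt
    -- The plane spanned by the first two eigenvectors meets the hyperplane of sum zero.
    obtain ⟨s, t, hst, hsum⟩ : ∃ s t : ℝ, 0 < s ^ 2 + t ^ 2 ∧
        s * ∑ u, v0 u + t * ∑ u, v1 u = 0 := by
      by_cases h : ∑ u, v0 u = 0
      · exact ⟨1, 0, by norm_num, by rw [h]; ring⟩
      · refine ⟨∑ u, v1 u, -∑ u, v0 u, ?_, by ring⟩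
        have := sq_pos_of_ne_zero (neg_ne_zero.mpr h)
        positivity
    have hfm := hform (fun u => s * v0 u + t * v1 u) (by
      rw [sum_add_distrib, ← mul_sum, ← mul_sum, hsum])
    have o00 : ∑ u, v0 u * v0 u = 1 := by rw [hv0, horth, if_pos rfl]
    have o11 : ∑ u, v1 u * v1 u = 1 := by rw [hv1, horth, if_pos rfl]
    have o01 : ∑ u, v0 u * v1 u = 0 := by
      rw [hv0, hv1, horth, if_neg]
      intro h
      have := ε.injective h
      simp at this
    have hexp : ∀ x y : ℝ, ∑ u, (s * v0 u + t * v1 u) * (s * (x * v0 u) + t * (y * v1 u))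
        = s ^ 2 * x + t ^ 2 * y := by
      intro x y
      have : ∀ u, (s * v0 u + t * v1 u) * (s * (x * v0 u) + t * (y * v1 u))
          = s ^ 2 * x * (v0 u * v0 u) + t ^ 2 * y * (v1 u * v1 u)
            + (s * t * x + s * t * y) * (v0 u * v1 u) := fun u => by ring
      simp only [this, sum_add_distrib, ← mul_sum, o00, o11, o01]
      ring
    have hL : ∑ u, (s * v0 u + t * v1 u) * neighborSum G (fun w => s * v0 w + t * v1 w) u
        = s ^ 2 * e0 + t ^ 2 * e1 := by
      rw [← hexp]
      refine sum_congr rfl fun u _ => ?_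
      rw [neighborSum_linear, hv0, hv1, hAv, hAv, hev, hev]
    have hR : ∑ u, (s * v0 u + t * v1 u) ^ 2 = s ^ 2 + t ^ 2 := by
      have := hexp 1 1
      simp only [one_mul, mul_one, ← pow_two] at this
      exact this
    rw [hL, hR] at hfm
    nlinarith [sq_nonneg s, sq_nonneg t]
  · by_contra hlt
    push Not at hlt
    -- If the second eigenvalue were below `lam`, the eigenspace would be orthogonal to every
    -- eigenvector but the first, hence of dimension at most one.
    have hle : Module.End.eigenspace (Matrix.toLin' (G.adjMatrix ℝ)) lam
        ≤ Submodule.span ℝ {v0} := by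
      intro w hw
      rw [Module.End.mem_eigenspace_iff, Matrix.toLin'_apply] at hw
      have hw' : ∀ u, neighborSum G w u = lam * w u := fun u => by
        rw [← adjMatrix_mulVec_eq_neighborSum, hw]; simp
      have hc : ∀ j, j ≠ ε ⟨0, by omega⟩ → ∑ u, v j u * w u = 0 := by
        intro j hj
        have h1 := sum_mul_neighborSum_comm G (v j) w
        have h2 : ∑ u, v j u * neighborSum G w u = lam * ∑ u, v j u * w u := by
          rw [mul_sum]
          exact sum_congr rfl fun u _ => by rw [hw']; ring
        have h3 : ∑ u, w u * neighborSum G (v j) u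
            = hA.eigenvalues j * ∑ u, v j u * w u := by
          rw [mul_sum]
          exact sum_congr rfl fun u _ => by rw [hAv]; ring
        have h4 : hA.eigenvalues j ≤ e1 := by
          rw [← ε.apply_symm_apply j, hev]
          apply hA.eigenvalues₀_antitone
          rw [Fin.le_def]
          by_contra hcon
          apply hj
          rw [← ε.symm_apply_eq]
          ext
          simp only at hcon ⊢
          omega
        have h5 : (lam - hA.eigenvalues j) * ∑ u, v j u * w u = 0 := by
          rw [sub_mul, ← h2, ← h3, h1, sub_self]
        rcases mul_eq_zero.mp h5 with h6 | h6
        · linarith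
        · exact h6
      have hrep := hA.eigenvectorBasis.sum_repr' (WithLp.toLp 2 w)
      rw [Fintype.sum_eq_single (ε ⟨0, by omega⟩)] at hrep
      · rw [Submodule.mem_span_singleton]
        exact ⟨_, congrArg WithLp.ofLp hrep⟩
      · intro j hj
        rw [EuclideanSpace.inner_eq_star_dotProduct]
        have : (WithLp.toLp 2 w).ofLp ⬝ᵥ star (hA.eigenvectorBasis j).ofLp = 0 := by
          rw [← hc j hj]
          simp [dotProduct, hv, mul_comm]
        rw [this, zero_smul]
    have h1 := Submodule.finrank_mono hle
    have h2 := finrank_span_le_card (R := ℝ) ({v0} : Set (V → ℝ))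
    rw [Set.toFinset_singleton, card_singleton] at h2
    rw [eigenvalueMultiplicity] at hmult
    omega

/-- A form bound below the minimum degree forces connectedness. -/
theorem preconnected_of_form_le (G : SimpleGraph V) (lam d : ℝ) (hd : lam < d)
    (hform : ∀ f : V → ℝ, ∑ u, f u = 0 → ∑ u, f u * neighborSum G f u ≤ lam * ∑ u, f u ^ 2)
    (hdeg : ∀ u, d ≤ neighborSum G (fun _ => 1) u) : G.Preconnected := by
  classical
  intro u₀ v₀
  by_contra hnot
  set C : Finset V := univ.filter fun w => G.Reachable u₀ w with hC
  -- A function of sum zero, constant on components: its form is at least `d` times its squared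
  -- norm, contradicting `lam < d`.
  set f : V → ℝ := fun w => if w ∈ C then ((univ \ C).card : ℝ) else -(C.card : ℝ) with hf
  have hu : u₀ ∈ C := by simp [hC]
  have hv : v₀ ∉ C := by simp [hC, hnot]
  have hsum : ∑ u, f u = 0 := by
    rw [← sum_sdiff (subset_univ C)]
    have h1 : ∑ u ∈ C, f u = ∑ u ∈ C, ((univ \ C).card : ℝ) :=
      sum_congr rfl fun u hu => by simp only [hf, if_pos hu]
    have h2 : ∑ u ∈ univ \ C, f u = ∑ u ∈ univ \ C, -(C.card : ℝ) :=
      sum_congr rfl fun u hu => by simp only [hf, if_neg (mem_sdiff.mp hu).2]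
    rw [h1, h2, sum_const, sum_const, nsmul_eq_mul, nsmul_eq_mul]
    ring
  have hadj : ∀ u w, G.Adj u w → f w = f u := by
    intro u w h
    have : w ∈ C ↔ u ∈ C := by
      simp only [hC, mem_filter, mem_univ, true_and]
      exact ⟨fun h' => h'.trans h.symm.reachable, fun h' => h'.trans h.reachable⟩
    simp only [hf, this]
  have hns : ∀ u, neighborSum G f u = neighborSum G (fun _ => 1) u * f u := by
    intro u
    rw [neighborSum, neighborSum, sum_mul]
    refine sum_congr rfl fun w _ => ?_
    split_ifs with h
    · rw [hadj u w h, one_mul]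
    · rw [zero_mul]
  have h1 := hform f hsum
  have h2 : d * ∑ u, f u ^ 2 ≤ ∑ u, f u * neighborSum G f u := by
    rw [mul_sum]
    refine sum_le_sum fun u _ => ?_
    rw [hns]
    nlinarith [hdeg u, sq_nonneg (f u)]
  have h3 : 0 < ∑ u, f u ^ 2 := by
    refine sum_pos' (fun _ _ => sq_nonneg _) ⟨v₀, mem_univ _, ?_⟩
    have : 0 < C.card := card_pos.mpr ⟨u₀, hu⟩
    simp only [hf, if_neg hv, neg_sq]
    positivity
  nlinarith

theorem degree_le_of_neighborSum_le (G : SimpleGraph V) [DecidableRel G.Adj] (D : ℕ) (u : V)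
    (h : neighborSum G (fun _ => 1) u ≤ D) : G.degree u ≤ D := by
  classical
  have h1 : neighborSum G (fun _ => 1) u = G.degree u := by
    rw [← adjMatrix_mulVec_eq_neighborSum, ← SimpleGraph.card_neighborFinset_eq_degree,
      SimpleGraph.adjMatrix_mulVec_apply]
    simp
  rw [h1] at h
  exact_mod_cast h

theorem neighborSum_comap {W : Type*} [Fintype W] (G : SimpleGraph V) (ε : W ≃ V) (f : W → ℝ)
    (u : W) : neighborSum (G.comap ε) f u = neighborSum G (fun x => f (ε.symm x)) (ε u) := by
  classical
  rw [neighborSum, neighborSum, ← Equiv.sum_comp ε]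
  refine sum_congr rfl fun w _ => ?_
  rw [Equiv.symm_apply_apply]
  exact if_congr Iff.rfl rfl rfl

/-- Spectral data on an arbitrary finite vertex type give a graph on `Fin n`. -/
theorem exists_graph_fin (G : SimpleGraph V) (lam d : ℝ) (D k : ℕ) (hk : 2 ≤ k)
    (hform : ∀ f : V → ℝ, ∑ u, f u = 0 → ∑ u, f u * neighborSum G f u ≤ lam * ∑ u, f u ^ 2)
    (hd : lam < d) (hdeg : ∀ u, d ≤ neighborSum G (fun _ => 1) u)
    (hD : ∀ u, neighborSum G (fun _ => 1) u ≤ D)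
    (f : Fin k → V → ℝ) (hf : LinearIndependent ℝ f)
    (heig : ∀ i u, neighborSum G (f i) u = lam * f i u) :
    ∃ (H : SimpleGraph (Fin (Fintype.card V))) (_ : DecidableRel H.Adj),
      H.Connected ∧ (∀ v, H.degree v ≤ D) ∧ HasSecondEigenvalue H lam ∧
        k ≤ eigenvalueMultiplicity H lam := by
  classical
  set ε : Fin (Fintype.card V) ≃ V := (Fintype.equivFin V).symm with hε
  have hform' : ∀ g : Fin (Fintype.card V) → ℝ, ∑ u, g u = 0 →
      ∑ u, g u * neighborSum (G.comap ε) g u ≤ lam * ∑ u, g u ^ 2 := by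
    intro g hg
    have h := hform (fun x => g (ε.symm x)) (by rw [Equiv.sum_comp ε.symm g, hg])
    rw [← Equiv.sum_comp ε, ← Equiv.sum_comp ε (fun x => g (ε.symm x) ^ 2)] at h
    simpa only [neighborSum_comap, Equiv.symm_apply_apply] using h
  have hmult : k ≤ eigenvalueMultiplicity (G.comap ε) lam := by
    refine card_le_eigenvalueMultiplicity _ lam (fun i u => f i (ε u)) ?_ ?_
    · exact hf.map' (LinearMap.funLeft ℝ ℝ ε)
        (LinearMap.ker_eq_bot.mpr (LinearMap.funLeft_injective_of_surjective ℝ ℝ ε ε.surjective))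
    · intro i u
      rw [neighborSum_comap]
      simp only [Equiv.apply_symm_apply]
      exact heig i (ε u)
  have hsec := hasSecondEigenvalue_of_form_le (G.comap ε) lam hform' (hk.trans hmult)
  have : Nonempty (Fin (Fintype.card V)) := ⟨⟨1, by simpa using hsec.1⟩⟩
  refine ⟨G.comap ε, inferInstance, ⟨preconnected_of_form_le _ lam d hd hform' fun u => ?_⟩,
    fun u => degree_le_of_neighborSum_le _ D u ?_, hsec, hmult⟩
  · rw [neighborSum_comap]; exact hdeg _
  · rw [neighborSum_comap]; exact hD _

end Criterion

/-! ### Choice of parameters -/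

section Final

theorem log_log_mul_pow_le (C : ℕ) (hC : 0 < C) :
    ∃ K : ℕ, ∀ k : ℕ, K ≤ k → Real.log (Real.log ((C * 32 ^ k : ℕ) : ℝ)) ≤ k := by
  refine ⟨⌈4 * Real.log C + 4 * Real.log 32⌉₊ + 1, fun k hk => ?_⟩
  have hCpos : (0 : ℝ) < C := by exact_mod_cast hC
  have hlogC : 0 ≤ Real.log C := Real.log_nonneg (by exact_mod_cast hC)
  have hlog32 : 0 < Real.log 32 := Real.log_pos (by norm_num)
  have hk1 : 4 * Real.log C + 4 * Real.log 32 ≤ k := by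
    have h1 := Nat.le_ceil (4 * Real.log C + 4 * Real.log 32)
    have h2 : ((⌈4 * Real.log C + 4 * Real.log 32⌉₊ + 1 : ℕ) : ℝ) ≤ k := by exact_mod_cast hk
    push_cast at h2
    linarith
  have hk0 : (1 : ℝ) ≤ k := by
    have : 1 ≤ k := by omega
    exact_mod_cast this
  set x := Real.log C + k * Real.log 32 with hx
  have hlog : Real.log ((C * 32 ^ k : ℕ) : ℝ) = x := by
    push_cast
    rw [Real.log_mul hCpos.ne' (by positivity), Real.log_pow]
  have hxpos : 0 < x := by
    have : 0 < (k : ℝ) * Real.log 32 := by positivity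
    linarith
  rw [hlog]
  -- The choice of `K` gives x ≤ k²/4, and log x ≤ 2(√x - 1).
  have h1 : Real.log x = 2 * Real.log (√x) := by
    rw [Real.log_sqrt hxpos.le]; ring
  have h2 : Real.log (√x) ≤ √x - 1 := Real.log_le_sub_one_of_pos (Real.sqrt_pos.mpr hxpos)
  have h3 : √x ≤ k / 2 := by
    rw [Real.sqrt_le_left (by positivity)]
    nlinarith
  linarith

/-- The graphs `switchGraph`, for growing `k`, witness the property. -/
theorem hasLogLogMultiplicity_of_parameters (r : ℕ) {Y : Type} [AddCommGroup Y] [Fintype Y]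
    [DecidableEq Y] (hY : Fintype.card Y = r + 4416) (Da Db : Finset Y)
    (ha : ∀ d ∈ Da, -d ∈ Da) (ha0 : (0 : Y) ∉ Da) (hb : ∀ d ∈ Db, -d ∈ Db)
    (lam κ : ℝ) (hr : 4416 ≤ r) (hκ : 0 < κ)
    (hDa : Da.card ≤ 3) (hDb : Db.card ≤ 3) (h1 : Da.card + ((r : ℝ) + 4404) * κ = lam)
    (h2 : -(Db.card : ℝ) + ((r : ℝ) + 4404) * κ⁻¹ = lam) (h3 : (r : ℝ) + 4403 ≤ lam)
    (h4 : 8835 ≤ lam) (h5 : lam < r + 4416) : HasLogLogMultiplicity 1 lam := by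
  have e : Y ≃ SwitchIndex ⊕ Fin r := Fintype.equivOfCardEq (by
    rw [hY]; simp; omega)
  have hcard : ∀ k, Fintype.card ((Position k × Y) ⊕ (Position k × Y))
      = 2 * (r + 4416) * 32 ^ k := by
    intro k
    simp only [Fintype.card_sum, Fintype.card_prod, Fintype.card_fun, ZMod.card,
      Fintype.card_bool, Fintype.card_fin, hY]
    rw [show 2 * (2 * k) = 4 * k by ring, pow_mul, show (32 : ℕ) = 2 ^ 4 * 2 by norm_num, mul_pow]
    ring
  obtain ⟨K, hK⟩ := log_log_mul_pow_le (2 * (r + 4416)) (by omega)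
  refine ⟨r + 4416 + 3, ?_⟩
  refine Set.infinite_of_injective_forall_mem
    -- The shift by `K` serves the logarithmic bound, the shift by 2 makes the multiplicity at least
    -- two.
    (f := fun j : ℕ => 2 * (r + 4416) * 32 ^ (j + K + 2)) ?_ ?_
  · intro i j hij
    have h6 := Nat.eq_of_mul_eq_mul_left (by omega) hij
    have h7 := Nat.pow_right_injective (le_refl 2 |>.trans (by norm_num) : 2 ≤ 32) h6
    omega
  · intro j
    set k := j + K + 2 with hk
    have hk0 : 0 < k := by omega
    have hdeg : ∀ u, ((r : ℝ) + 4416)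
        ≤ neighborSum (switchGraph hk0 e Da Db ha ha0 hb) (fun _ => 1) u ∧
        neighborSum (switchGraph hk0 e Da Db ha ha0 hb) (fun _ => 1) u
          ≤ ((r + 4416 + 3 : ℕ) : ℝ) := by
      have hYr : (Fintype.card Y : ℝ) = r + 4416 := by rw [hY]; push_cast; ring
      have hDa' : (Da.card : ℝ) ≤ 3 := by exact_mod_cast hDa
      have hDb' : (Db.card : ℝ) ≤ 3 := by exact_mod_cast hDb
      have hDa0 : (0 : ℝ) ≤ Da.card := Nat.cast_nonneg _
      have hDb0 : (0 : ℝ) ≤ Db.card := Nat.cast_nonneg _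
      rintro (⟨p, y⟩ | ⟨p, y⟩)
      · rw [neighborSum_one_inl, hYr]
        push_cast
        constructor <;> linarith
      · rw [neighborSum_one_inr, hYr]
        push_cast
        constructor <;> linarith
    obtain ⟨H, dec, hconn, hD, hsec, hmult⟩ := exists_graph_fin
      (switchGraph hk0 e Da Db ha ha0 hb) lam ((r : ℝ) + 4416) (r + 4416 + 3) k (by omega)
      (switchGraph_form_le hk0 e Da Db ha ha0 hb lam κ hr hκ hDa hDb h1 h2 h3 h4) h5
      (fun u => (hdeg u).1) (fun u => (hdeg u).2) (labelVector κ)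
      (linearIndependent_labelVector κ)
      (neighborSum_labelVector hk0 e Da Db ha ha0 hb lam κ hκ h1 h2)
    have hlog := hK k (by omega)
    change ∃ (G : SimpleGraph (Fin (2 * (r + 4416) * 32 ^ k))) (_ : DecidableRel G.Adj),
      G.Connected ∧ (∀ v, G.degree v ≤ r + 4416 + 3) ∧ HasSecondEigenvalue G lam ∧
        1 * Real.log (Real.log ((2 * (r + 4416) * 32 ^ k : ℕ) : ℝ))
          ≤ (eigenvalueMultiplicity G lam : ℝ)
    rw [← hcard k] at hlog ⊢
    refine ⟨H, dec, hconn, hD, hsec, ?_⟩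
    rw [one_mul]
    exact hlog.trans (by exact_mod_cast hmult)

theorem hasLogLogMultiplicity_natCast (m : ℕ) (hm : 8835 ≤ m) :
    HasLogLogMultiplicity 1 (m : ℝ) := by
  obtain ⟨r, rfl⟩ := Nat.exists_eq_add_of_le' (show 4404 ≤ m by omega)
  have : NeZero (r + 4416) := ⟨by omega⟩
  refine hasLogLogMultiplicity_of_parameters r (Y := ZMod (r + 4416)) (ZMod.card _) ∅ ∅
    (by simp) (by simp) (by simp) _ 1 (by omega) one_pos (by simp) (by simp) (by simp) (by simp)
    ?_ ?_ ?_
  · push_cast; linarith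
  · exact_mod_cast hm
  · push_cast; linarith

theorem hasLogLogMultiplicity_sqrt (u : ℕ) (hu : 4420 ≤ u) :
    HasLogLogMultiplicity 1 (2 * √((u : ℝ) ^ 2 + 1) - 1) := by
  obtain ⟨r, hr⟩ := Nat.exists_eq_add_of_le' (show 4404 ≤ 2 * u by omega)
  have : NeZero (r + 4416) := ⟨by omega⟩
  have hur : (r : ℝ) + 4404 = 2 * u := by exact_mod_cast hr.symm
  have hu0 : (4420 : ℝ) ≤ u := by exact_mod_cast hu
  set s := √((u : ℝ) ^ 2 + 1) with hs
  have hs2 : s ^ 2 = (u : ℝ) ^ 2 + 1 := Real.sq_sqrt (by positivity)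
  have hs0 : 0 ≤ s := Real.sqrt_nonneg _
  have hsu : (u : ℝ) ≤ s := by nlinarith
  have hsu' : s ≤ u + 1 := by nlinarith
  -- The element of order two: r + 4416 = 2(u + 6). It gives a symmetric set of size one avoiding
  -- zero.
  set h : ZMod (r + 4416) := ((u + 6 : ℕ) : ZMod (r + 4416)) with hh
  have hhalf : -h = h := by
    rw [neg_eq_iff_add_eq_zero, hh, ← Nat.cast_add, ZMod.natCast_eq_zero_iff]
    exact ⟨1, by omega⟩
  have hh0 : h ≠ 0 := by
    rw [hh, Ne, ZMod.natCast_eq_zero_iff]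
    intro hdvd
    have := Nat.le_of_dvd (by omega) hdvd
    omega
  have hone : (1 : ZMod (r + 4416)) ≠ 0 := by
    have : ((1 : ℕ) : ZMod (r + 4416)) ≠ 0 := by
      rw [Ne, ZMod.natCast_eq_zero_iff]
      intro hdvd
      have := Nat.le_of_dvd (by omega) hdvd
      omega
    simpa using this
  have htwo : (1 : ZMod (r + 4416)) ≠ -1 := by
    have : ((2 : ℕ) : ZMod (r + 4416)) ≠ 0 := by
      rw [Ne, ZMod.natCast_eq_zero_iff]
      intro hdvd
      have := Nat.le_of_dvd (by omega) hdvd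
      omega
    intro heq
    apply this
    rw [eq_neg_iff_add_eq_zero] at heq
    push_cast
    rw [← heq]; norm_num
  have hcard : ({0, 1, -1} : Finset (ZMod (r + 4416))).card = 3 := by
    rw [card_eq_three]
    exact ⟨0, 1, -1, hone.symm, by simpa using hone, htwo, rfl⟩
  have hsone : 0 < s - 1 := by linarith
  have hu1 : (0 : ℝ) < u := by linarith
  have hinv : ((s - 1) / u)⁻¹ = (s + 1) / u := by
    rw [inv_div, div_eq_div_iff hsone.ne' hu1.ne']
    linarith
  -- With p = 1 and q = 3 the eigenvalue satisfies (λ - 1)(λ + 3) = (2u)², so (λ + 1)² = 4(u² + 1).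
  -- Zero is allowed in the second set, since the label flip already excludes loops.
  refine hasLogLogMultiplicity_of_parameters r (Y := ZMod (r + 4416)) (ZMod.card _) {h} {0, 1, -1}
    ?_ ?_ ?_ _ ((s - 1) / u) (by omega) (by positivity) (by simp) hcard.le ?_ ?_ ?_ ?_ ?_
  · intro d hd
    rw [mem_singleton] at hd ⊢
    rw [hd, hhalf]
  · rw [mem_singleton]; exact hh0.symm
  · intro d hd
    simp only [mem_insert, mem_singleton] at hd ⊢
    rcases hd with rfl | rfl | rfl <;> simp
  · rw [card_singleton, hur]
    field_simp
    push_cast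
    ring
  · rw [hcard, hur, hinv]
    field_simp
    push_cast
    ring
  · linarith
  · linarith
  · linarith

end Final

theorem theorem1p3 :
    ∃ c : ℝ, 0 < c ∧
      {lam : ℝ | 0 < lam ∧ HasLogLogMultiplicity c lam}.Infinite ∧
      (∃ L : ℤ, ∀ m : ℤ, L ≤ m → HasLogLogMultiplicity c (m : ℝ)) ∧
      (∃ U : ℤ, ∀ u : ℤ, U ≤ u →
        HasLogLogMultiplicity c (2 * Real.sqrt ((u : ℝ) ^ 2 + 1) - 1)) := by
  refine ⟨1, one_pos, ?_, ⟨8835, fun m hm => ?_⟩, ⟨4420, fun u hu => ?_⟩⟩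
  · refine Set.infinite_of_injective_forall_mem (f := fun j : ℕ => ((j + 8835 : ℕ) : ℝ)) ?_ ?_
    · intro i j hij
      have := Nat.cast_injective hij
      omega
    · intro j
      exact ⟨by positivity, hasLogLogMultiplicity_natCast _ (by omega)⟩
  · lift m to ℕ using by omega
    exact_mod_cast hasLogLogMultiplicity_natCast m (by omega)
  · lift u to ℕ using by omega
    exact_mod_cast hasLogLogMultiplicity_sqrt u (by omega)
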